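/- Round-robin efficiency. Let $n\ge 1$ players play a round-robin tournament in which every pair $\{i,j\}$ plays $2k$ games ($k\ge 1$), with independent binomial outcomes following the Bradley–Terry model: for $i<j$, the number $X_{ij}$ of wins of $i$ over $j$ is $\mathrm{Bin}(2k,p_{ij})$ with $\log\frac{p_{ij}}{1-p_{ij}}=\mu_i-\mu_j$. Assume equal abilities, $\mu_1=\dots=\mu_n$, so that $p_{ij}=\tfrac12$. The results matrix has $c_{ij}=X_{ij}$, $c_{ji}=2k-X_{ij}$ for $i<j$, and $c_{ii}=k$; its mean is $C=k\,ee^T$, and it is the matrix $C_t=C+\sum_{i<j}t_{ij}F_{ij}$ at $t_{ij}=X_{ij}-k$, where $F_{ij}$ has entries $1$ at $(i,j)$, $-1$ at $(j,i)$ and $0$ elsewhere. The normalized influence weight of a results matrix is the vector $w\ge 0$ with $\sum_i w_i=1$ and $w_i=\sum_j w_jc_{ij}\big/\sum_j c_{ji}$ for all $i$. Log-abilities are normalized in the same way, by $\sum_i e^{\mu_i}=1$; write $\theta_i=\mu_i-\log\sum_j e^{\mu_j}$. (1) For every $k\ge1$ the normalized influence weight of $C_t$ is unique for $t$ near $0$,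 and its entrywise logarithm is differentiable in $t\in\mathbb R^{\binom n2}$ at $t=0$. If $J$ is the Jacobian there and $\Sigma$ is the covariance matrix of $(X_{ij})_{i<j}$, then the delta-method covariance matrix $V_k=J\Sigma J^T$ is $$[V_k]_{ij}=\begin{cases}\dfrac{2(n-1)}{kn^2}& i=j,\\[1ex] \dfrac{-2}{kn^2}& i\ne j.\end{cases}$$ (2) $V_k$ is the asymptotic covariance matrix of the Bradley–Terry maximum likelihood estimator $\hat\theta_k$ of the normalized log-abilities: as $k\to\infty$ with $n$ fixed, $\hat\theta_k$ exists and is unique with probability tending to $1$, and $\sqrt k(\hat\theta_k-\theta)$ converges in distribution to $N(0,kV_k)$ (where $kV_k$ does not depend on $k$). For every $k\ge 1$, $V_k$ is also the Cramér–Rao bound $D\,I_k(\mu)^{\dagger}D^T$ for $\theta$, where $I_k(\mu)$ is the Fisher information matrix of the model, $^{\dagger}$ is the Moore–Penrose inverse, and $D$ is the Jacobian of $\mu\mapsto\theta$. (3) Hence $\log w$ is an asymptotically efficient estimator of the Bradley–Terry log-abilities there: as $k\to\infty$, the normalized influence weight $w$ of the results matrix is unique with probability tending to $1$, and $\sqrt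 k(\log w-\theta)$ converges in distribution to $N(0,kV_k)$, so that its asymptotic covariance attains the Cramér–Rao bound and equals that of the maximum likelihood estimator. -/

import Mathlib

open MeasureTheory ProbabilityTheory Filter Topology

noncomputable section

namespace RoundRobin

/-- The unordered pairs of players, each listed once as `(i, j)` with `i < j`. -/
abbrev Pair (n : ℕ) : Type := {p : Fin n × Fin n // p.1 < p.2}

/-! ### Results matrices and influence weight -/

/-- `w` is a normalized influence weight of the results matrix `C` (`C i j` is the number of times
`i` beats `j`): it is nonnegative, has total mass one, and satisfies
`w i = (∑ j, w j * C i j) / (∑ j, C j i)`. In other words it is a leading right eigenvector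
(eigenvalue one) of `A⁻¹ C`, with `A` the diagonal matrix of the column sums of `C`. -/
def IsInfluenceWeight {n : ℕ} (C : Matrix (Fin n) (Fin n) ℝ) (w : Fin n → ℝ) : Prop :=
  (∀ i, 0 ≤ w i) ∧ ∑ i, w i = 1 ∧ ∀ i, w i = (∑ j, w j * C i j) / ∑ j, C j i

open Classical in
/-- The normalized influence weight of `C` (zero if there is none). -/
def influenceWeight {n : ℕ} (C : Matrix (Fin n) (Fin n) ℝ) : Fin n → ℝ :=
  if h : ∃ w, IsInfluenceWeight C w then h.choose else 0

/-- The matrix `k e eᵀ`, perturbed by `t p` in entry `(i, j)` and by `-t p` in entry `(j, i)`, for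
each pair `p = (i, j)`, `i < j`. -/
def perturbedMatrix (n k : ℕ) (t : Pair n → ℝ) : Matrix (Fin n) (Fin n) ℝ :=
  (k : ℝ) • Matrix.vecMulVec 1 1 +
    ∑ p : Pair n, t p • (Matrix.single p.1.1 p.1.2 1 - Matrix.single p.1.2 p.1.1 1)

/-- The log influence weight as a function of the perturbation. -/
def logInfluenceWeight (n k : ℕ) (t : Pair n → ℝ) : Fin n → ℝ :=
  fun i => Real.log (influenceWeight (perturbedMatrix n k t) i)

/-- The perturbation of `k e eᵀ` given by the data `x`, where each pair `p = (i, j)` plays `2k`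
games and `x p` of them are won by `i`. The results matrix is
`perturbedMatrix n k (deviation n k x)`, with entry `x p` at `(i, j)` and `2k - x p` at `(j, i)`. -/
def deviation (n k : ℕ) (x : Pair n → ℕ) : Pair n → ℝ := fun p => (x p : ℝ) - k

/-- The log influence weight of the data, as an estimator. -/
def logInfluenceWeightEstimator (n k : ℕ) (x : Pair n → ℕ) : Fin n → ℝ :=
  logInfluenceWeight n k (deviation n k x)

/-! ### The Bradley–Terry model -/

/-- The Bradley–Terry round robin with log-abilities `μ`: independent numbers of wins, binomial with
`2k` trials and with log odds `μ i - μ j` that `i` beats `j`, one for each pair `i < j`. -/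
def tournamentLaw (n k : ℕ) (μ : Fin n → ℝ) : Measure (Pair n → ℕ) :=
  Measure.pi fun p : Pair n => binomial (2 * k) (unitInterval.sigmoid (μ p.1.1 - μ p.1.2))

instance (n k : ℕ) (μ : Fin n → ℝ) : IsProbabilityMeasure (tournamentLaw n k μ) := by
  unfold tournamentLaw
  infer_instance

/-- The likelihood of the log-abilities `μ` given the data `x`. -/
def likelihood (n k : ℕ) (x : Pair n → ℕ) (μ : Fin n → ℝ) : ℝ :=
  (tournamentLaw n k μ).real {x}

/-- `μ` maximizes the likelihood. Since log-abilities are identified only up to a common additive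
constant, they are normalized here like the influence weight: the abilities `exp (μ i)` sum to
one. -/
def IsMLE (n k : ℕ) (x : Pair n → ℕ) (μ : Fin n → ℝ) : Prop :=
  ∑ i, Real.exp (μ i) = 1 ∧ ∀ ν : Fin n → ℝ, likelihood n k x ν ≤ likelihood n k x μ

open Classical in
/-- The Bradley–Terry maximum likelihood estimator of the log-abilities (zero if there is none). -/
def logAbilityMLE (n k : ℕ) (x : Pair n → ℕ) : Fin n → ℝ :=
  if h : ∃ μ, IsMLE n k x μ then h.choose else 0

/-- The log-abilities `μ`, shifted so that the abilities sum to one. -/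
def normalizedLogAbility {n : ℕ} (μ : Fin n → ℝ) : Fin n → ℝ :=
  fun i => μ i - Real.log (∑ j, Real.exp (μ j))

/-! ### Delta method and asymptotic efficiency -/

/-- The Jacobian matrix of `f` at `x`. -/
def jacobian {ι κ : Type*} [Fintype ι] [DecidableEq ι] [Fintype κ]
    (f : (ι → ℝ) → (κ → ℝ)) (x : ι → ℝ) : Matrix κ ι ℝ :=
  LinearMap.toMatrix' (fderiv ℝ f x : (ι → ℝ) →ₗ[ℝ] (κ → ℝ))

/-- The covariance matrix of the numbers of wins. -/
def dataCovariance (n k : ℕ) (μ : Fin n → ℝ) : Matrix (Pair n) (Pair n) ℝ :=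
  Matrix.of fun p q =>
    covariance (fun x : Pair n → ℕ => (x p : ℝ)) (fun x => (x q : ℝ)) (tournamentLaw n k μ)

/-- The first-order (delta method) covariance matrix `J Σ Jᵀ` of the log influence weight, where `J`
is its Jacobian at the unperturbed matrix `k e eᵀ`. -/
def deltaCovariance (n k : ℕ) (μ : Fin n → ℝ) : Matrix (Fin n) (Fin n) ℝ :=
  jacobian (logInfluenceWeight n k) 0 * dataCovariance n k μ *
    (jacobian (logInfluenceWeight n k) 0).transpose

/-- The Fisher information matrix of the Bradley–Terry round robin at `μ`: the second moment matrix
of the score vector. It is singular, since the likelihood is invariant under common shifts. -/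
def fisherInformation (n k : ℕ) (μ : Fin n → ℝ) : Matrix (Fin n) (Fin n) ℝ :=
  Matrix.of fun i j => ∫ x,
    fderiv ℝ (fun ν => Real.log (likelihood n k x ν)) μ (Pi.single i 1) *
      fderiv ℝ (fun ν => Real.log (likelihood n k x ν)) μ (Pi.single j 1) ∂tournamentLaw n k μ

/-- `G` is the Moore–Penrose inverse of `M`. -/
def IsMoorePenroseInverse {n : ℕ} (M G : Matrix (Fin n) (Fin n) ℝ) : Prop :=
  M * G * M = M ∧ G * M * G = G ∧ (M * G).transpose = M * G ∧ (G * M).transpose = G * M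

/-- `V` is the Cramér–Rao bound at `μ` for the normalized log-abilities, which are an identified
(shift-invariant) function of `μ`: with `D` the Jacobian of this function, `V = D I(μ)⁺ Dᵀ`. -/
def IsCramerRaoBound (n k : ℕ) (μ : Fin n → ℝ) (V : Matrix (Fin n) (Fin n) ℝ) : Prop :=
  ∃ G, IsMoorePenroseInverse (fisherInformation n k μ) G ∧
    V = jacobian normalizedLogAbility μ * G * (jacobian normalizedLogAbility μ).transpose

/-- Under the Bradley–Terry model with log-abilities `μ`, the estimators `T k` of the normalized
log-abilities are asymptotically normal as `k → ∞`, with asymptotic covariance matrix `V k`: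
`√k (T k - θ)` converges in distribution to `N(0, S)`, and `V k = S / k`. -/
def HasAsymptoticCovariance {n : ℕ} (T : ℕ → (Pair n → ℕ) → Fin n → ℝ) (μ : Fin n → ℝ)
    (V : ℕ → Matrix (Fin n) (Fin n) ℝ) : Prop :=
  ∃ S : Matrix (Fin n) (Fin n) ℝ, S.PosSemidef ∧ (∀ k : ℕ, 0 < k → V k = (k : ℝ)⁻¹ • S) ∧
    TendstoInDistribution
      (fun (k : ℕ) (x : Pair n → ℕ) =>
        √(k : ℝ) • (WithLp.toLp 2 (T k x - normalizedLogAbility μ) : EuclideanSpace ℝ (Fin n)))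
      atTop (id : EuclideanSpace ℝ (Fin n) → EuclideanSpace ℝ (Fin n))
      (fun k => tournamentLaw n k μ) (multivariateGaussian 0 S)

/-- Asymptotic efficiency at `μ`: the estimators `T k` are asymptotically normal, centred at the
normalized log-abilities, and their asymptotic covariance attains the Cramér–Rao bound. -/
def IsAsymptoticallyEfficientAt {n : ℕ} (T : ℕ → (Pair n → ℕ) → Fin n → ℝ)
    (μ : Fin n → ℝ) : Prop :=
  ∃ V : ℕ → Matrix (Fin n) (Fin n) ℝ,
    (∀ k : ℕ, 0 < k → IsCramerRaoBound n k μ (V k)) ∧ HasAsymptoticCovariance T μ V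

end RoundRobin

end

noncomputable section

namespace RoundRobin

/-! Write F for the incidence matrix of the complete graph and s = t/k for the relative deviations
of the results. Both estimators are smooth functions of s near 0, the same function for every k, and
both have the expansion -log n + (2/n) F s + o(s). All claims follow from this common linearization.

For the influence weight (`exists_log_influenceWeight`), clearing denominators turns the fixed-point
equation into a linear system (n - B(s)) w = 1 with B linear in s, solved by inverting near n. For
the maximum likelihood estimator (`exists_mle`), the likelihood equations together with the
normalization read Φ(ν) = F s. The inverse function theorem applies, and strict concavity makes the
solution the unique maximizer.

The counts are independent with variance k/2, so F s√k is asymptotically Gaussian with covariance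
L/2, where L = F Fᵀ = nI - eeᵀ. Hence V_k = (2/(kn²)) L. The transfer from linear part to estimator
is `tendstoInDistribution_estimator`, by characteristic functions. The Fisher information is (k/2)
L, and L² = nL makes V_k its Moore–Penrose inverse; D fixes L, so V_k is also the Cramér–Rao bound.
-/

variable {n : ℕ}

/-! ### Incidence matrix and Laplacian of the complete graph -/

/-- The incidence matrix of the round robin: `1` at the first and `-1` at the second player of
each pair. -/
def incidence (n : ℕ) : Matrix (Fin n) (Pair n) ℝ :=
  Matrix.of fun i p => (if i = p.1.1 then 1 else 0) - (if i = p.1.2 then 1 else 0)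

lemma incidence_apply (i : Fin n) (p : Pair n) :
    incidence n i p = (if i = p.1.1 then 1 else 0) - (if i = p.1.2 then 1 else 0) := rfl

/-- Converts sums over games into double sums over players; this is how the Laplacian is evaluated.
-/
lemma sum_pair (f : Fin n → Fin n → ℝ) :
    ∑ i, ∑ j, f i j = ∑ i, f i i + ∑ p : Pair n, (f p.1.1 p.1.2 + f p.1.2 p.1.1) := by
  have h1 (g : Fin n → Fin n → ℝ) :
      ∑ p : Pair n, g p.1.1 p.1.2 = ∑ i, ∑ j, if i < j then g i j else 0 := by
    rw [← Fintype.sum_prod_type' (f := fun i j => if i < j then g i j else 0),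
      ← Finset.sum_filter, ← Finset.sum_subtype_eq_sum_filter]
    simp only [Finset.subtype_univ]
  rw [Finset.sum_add_distrib, h1, h1 fun i j => f j i,
    Finset.sum_comm (f := fun i j => if i < j then f j i else 0), ← Finset.sum_add_distrib,
    ← Finset.sum_add_distrib]
  refine Finset.sum_congr rfl fun i _ => ?_
  rw [← Fintype.sum_ite_eq i fun j => f i j, ← Finset.sum_add_distrib, ← Finset.sum_add_distrib]
  refine Finset.sum_congr rfl fun j _ => ?_
  rcases lt_trichotomy i j with h | h | h
  · simp [h, h.ne, h.not_gt]
  · simp [h]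
  · simp [h, h.ne', h.not_gt]

lemma sum_incidence (p : Pair n) : ∑ i, incidence n i p = 0 := by
  simp [incidence_apply]

lemma sum_incidence_mul (g : Pair n → ℝ) : ∑ i, ∑ p, incidence n i p * g p = 0 := by
  rw [Finset.sum_comm]
  simp [← Finset.sum_mul, sum_incidence]

lemma incidence_transpose_mulVec (v : Fin n → ℝ) (p : Pair n) :
    ((incidence n).transpose.mulVec v) p = v p.1.1 - v p.1.2 := by
  simp [Matrix.mulVec, dotProduct, incidence_apply, sub_mul]

/-- The Laplacian `F Fᵀ` of the complete graph. -/
def laplacian (n : ℕ) : Matrix (Fin n) (Fin n) ℝ := incidence n * (incidence n).transpose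

lemma sum_incidence_mul_sub (v : Fin n → ℝ) (i : Fin n) :
    ∑ p : Pair n, incidence n i p * (v p.1.1 - v p.1.2) = n * v i - ∑ j, v j := by
  have h := sum_pair fun a b => (if i = a then 1 else 0) * (v a - v b)
  simp only [ite_mul, one_mul, zero_mul, Finset.sum_ite_irrel, Finset.sum_const_zero,
    Finset.sum_ite_eq, Finset.mem_univ, if_true, sub_self, zero_add, Finset.sum_sub_distrib,
    Finset.sum_const, Finset.card_univ, Fintype.card_fin, nsmul_eq_mul] at h
  rw [h]
  refine Finset.sum_congr rfl fun p _ => ?_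
  rw [incidence_apply]
  split_ifs <;> ring

lemma laplacian_mulVec (v : Fin n → ℝ) (i : Fin n) :
    ((laplacian n).mulVec v) i = n * v i - ∑ j, v j := by
  rw [← sum_incidence_mul_sub, laplacian, ← Matrix.mulVec_mulVec]
  simp only [Matrix.mulVec, dotProduct, ← incidence_transpose_mulVec]

lemma laplacian_apply (i j : Fin n) :
    laplacian n i j = (if i = j then (n : ℝ) else 0) - 1 := by
  have h := laplacian_mulVec (Pi.single j 1) i
  simpa [Pi.single_apply] using h

/-- L/n is the orthogonal projection onto the vectors of sum zero. This identity yields the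
Moore–Penrose inverse L/n² of L. -/
lemma laplacian_mul_laplacian : laplacian n * laplacian n = (n : ℝ) • laplacian n := by
  ext i j
  have h := laplacian_mulVec (fun i => laplacian n i j) i
  rw [Matrix.mul_apply]
  simp only [Matrix.mulVec, dotProduct] at h
  rw [h]
  simp [laplacian_apply]

lemma laplacian_transpose : (laplacian n).transpose = laplacian n := by
  simp [laplacian]

lemma laplacian_posSemidef : (laplacian n).PosSemidef := by
  have := Matrix.posSemidef_self_mul_conjTranspose (incidence n)
  rwa [Matrix.conjTranspose_eq_transpose_of_trivial] at this

/-! ### The influence weight near the mean -/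

lemma perturbedMatrix_apply (k : ℕ) (t : Pair n → ℝ) (i j : Fin n) :
    perturbedMatrix n k t i j = k + ∑ p : Pair n, t p *
      ((if i = p.1.1 then 1 else 0) * (if j = p.1.2 then 1 else 0) -
        (if i = p.1.2 then 1 else 0) * (if j = p.1.1 then 1 else 0)) := by
  simp only [perturbedMatrix, Matrix.add_apply, Matrix.smul_apply, Matrix.vecMulVec_apply,
    Pi.one_apply, mul_one, smul_eq_mul, Matrix.sum_apply, Matrix.sub_apply, Matrix.single_apply]
  congr 1
  refine Finset.sum_congr rfl fun p _ => ?_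
  simp only [eq_comm (b := i), eq_comm (b := j)]
  congr 2 <;> split_ifs <;> simp_all

lemma sum_perturbedMatrix_col (k : ℕ) (t : Pair n → ℝ) (i : Fin n) :
    ∑ j, perturbedMatrix n k t j i = n * k - ∑ p, incidence n i p * t p := by
  simp only [perturbedMatrix_apply, Finset.sum_add_distrib]
  rw [Finset.sum_comm, sub_eq_add_neg, ← Finset.sum_neg_distrib]
  congr 1
  · simp
  refine Finset.sum_congr rfl fun p _ => ?_
  rw [← Finset.mul_sum, Finset.sum_sub_distrib, ← Finset.sum_mul, ← Finset.sum_mul]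
  simp only [Finset.sum_ite_eq', Finset.mem_univ, if_true, incidence_apply]
  ring

lemma sum_perturbedMatrix_row (k : ℕ) (t : Pair n → ℝ) (w : Fin n → ℝ) (i : Fin n) :
    ∑ j, w j * perturbedMatrix n k t i j = k * ∑ j, w j +
      ∑ p : Pair n, t p * ((if i = p.1.1 then 1 else 0) * w p.1.2 -
        (if i = p.1.2 then 1 else 0) * w p.1.1) := by
  simp only [perturbedMatrix_apply, mul_add, Finset.sum_add_distrib, Finset.mul_sum]
  congr 1
  · simp only [mul_comm]
  rw [Finset.sum_comm]
  refine Finset.sum_congr rfl fun p _ => ?_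
  have h (a b c : ℝ) (q r : Fin n) :
      ∑ j, w j * (c * (a * (if j = q then 1 else 0) - b * (if j = r then 1 else 0))) =
        c * (a * w q - b * w r) := by
    simp only [mul_sub, Finset.sum_sub_distrib]
    simp only [mul_ite, mul_one, mul_zero, Finset.sum_ite_eq', Finset.mem_univ, if_true]
    ring
  exact h _ _ _ _ _

/-- With t = ks the factor k cancels from numerator and denominator. After multiplying out, the term
w_i (F s)_i occurs on both sides and drops, leaving an equation linear in w. The hypothesis `hs`
says that no column sum vanishes. -/
lemma isInfluenceWeight_perturbedMatrix_iff {k : ℕ} (hk : 0 < k) {s : Pair n → ℝ}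
    (hs : ∀ i, ∑ p, incidence n i p * s p ≠ n) (w : Fin n → ℝ) :
    IsInfluenceWeight (perturbedMatrix n k ((k : ℝ) • s)) w ↔
      (∀ i, 0 ≤ w i) ∧ ∑ i, w i = 1 ∧
        ∀ i, n * w i - ∑ p, incidence n i p * (s p * (w p.1.1 + w p.1.2)) = 1 := by
  unfold IsInfluenceWeight
  refine and_congr_right fun _ => and_congr_right fun h1 => forall_congr' fun i => ?_
  have hk' : (k : ℝ) ≠ 0 := by positivity
  have e1 : ∑ j, perturbedMatrix n k ((k : ℝ) • s) j i = k * (n - ∑ p, incidence n i p * s p) := by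
    rw [sum_perturbedMatrix_col, mul_sub, Finset.mul_sum]
    congr 1
    · ring
    · exact Finset.sum_congr rfl fun p _ => by simp; ring
  have e2 : ∑ j, w j * perturbedMatrix n k ((k : ℝ) • s) i j =
      k * (1 + ∑ p, incidence n i p * (s p * (w p.1.1 + w p.1.2)) -
        w i * ∑ p, incidence n i p * s p) := by
    rw [sum_perturbedMatrix_row, h1, add_sub_assoc, mul_add, Finset.mul_sum,
      ← Finset.sum_sub_distrib, Finset.mul_sum]
    congr 1
    refine Finset.sum_congr rfl fun p _ => ?_
    rw [incidence_apply]
    simp only [Pi.smul_apply, smul_eq_mul]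
    split_ifs with h2 h3 h3
    · exact absurd (h2.symm.trans h3) p.2.ne
    · rw [h2]; ring
    · rw [h3]; ring
    · ring
  rw [e1, e2, mul_div_mul_left _ _ hk', eq_div_iff (sub_ne_zero.2 (hs i).symm)]
  constructor <;> intro h <;> linarith

/-- The incidence matrix as a continuous linear map. -/
def incidenceCLM (n : ℕ) : (Pair n → ℝ) →L[ℝ] (Fin n → ℝ) :=
  LinearMap.toContinuousLinearMap (incidence n).mulVecLin

lemma incidenceCLM_apply (s : Pair n → ℝ) (i : Fin n) :
    incidenceCLM n s i = ∑ p, incidence n i p * s p := rfl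

/-- The bilinear part of the equation of the influence weight. -/
def interaction (n : ℕ) : (Pair n → ℝ) →L[ℝ] (Fin n → ℝ) →L[ℝ] (Fin n → ℝ) :=
  LinearMap.toContinuousBilinearMap <|
    LinearMap.mk₂ ℝ (fun s w i => ∑ p, incidence n i p * (s p * (w p.1.1 + w p.1.2)))
      (fun _ _ _ => by
        ext i; simp only [Pi.add_apply, ← Finset.sum_add_distrib]
        exact Finset.sum_congr rfl fun _ _ => by ring)
      (fun _ _ _ => by
        ext i; simp only [Pi.smul_apply, smul_eq_mul, Finset.mul_sum]
        exact Finset.sum_congr rfl fun _ _ => by ring)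
      (fun _ _ _ => by
        ext i; simp only [Pi.add_apply, ← Finset.sum_add_distrib]
        exact Finset.sum_congr rfl fun _ _ => by ring)
      (fun _ _ _ => by
        ext i; simp only [Pi.smul_apply, smul_eq_mul, Finset.mul_sum]
        exact Finset.sum_congr rfl fun _ _ => by ring)

lemma interaction_apply (s : Pair n → ℝ) (w : Fin n → ℝ) (i : Fin n) :
    interaction n s w i = ∑ p, incidence n i p * (s p * (w p.1.1 + w p.1.2)) := rfl

theorem exists_log_influenceWeight (hn : 0 < n) :
    ∃ h : (Pair n → ℝ) → (Fin n → ℝ), HasFDerivAt h ((2 / n : ℝ) • incidenceCLM n) 0 ∧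
      (h 0 = fun _ => -Real.log n) ∧
      ∀ᶠ s in 𝓝 0, ∀ k : ℕ, 0 < k → ∀ w,
        IsInfluenceWeight (perturbedMatrix n k ((k : ℝ) • s)) w ↔ w = fun i => Real.exp (h s i) := by
  have hn' : (0 : ℝ) < n := by positivity
  let R := (Fin n → ℝ) →L[ℝ] (Fin n → ℝ)
  let u : Rˣ := ⟨(n : ℝ) • 1, (n : ℝ)⁻¹ • 1, by simp [smul_smul, hn'.ne'], by
    simp [smul_smul, hn'.ne']⟩
  let B : (Pair n → ℝ) → R := fun s => (n : ℝ) • 1 - interaction n s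
  have hB0 : B 0 = u := by simp [B, u]
  have hB : HasFDerivAt B (-(interaction n)) 0 := by
    simpa using (interaction n).hasFDerivAt.const_sub ((n : ℝ) • (1 : R))
  -- The linear system is B(s) w = 1, so its solution is differentiable wherever B(s) is invertible.
  let w : (Pair n → ℝ) → Fin n → ℝ := fun s => Ring.inverse (B s) 1
  have hw0 : w 0 = fun _ => (n : ℝ)⁻¹ := by
    simp only [w, hB0, Ring.inverse_unit]
    ext i
    simp [u]
  have hw : HasFDerivAt w ((2 / (n : ℝ) ^ 2) • incidenceCLM n) 0 := by
    have h1 := hasFDerivAt_ringInverse (𝕜 := ℝ) u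
    rw [← hB0] at h1
    have h2 := (ContinuousLinearMap.apply ℝ (Fin n → ℝ) (1 : Fin n → ℝ)).hasFDerivAt.comp 0
      (h1.comp 0 hB)
    refine h2.congr_fderiv ?_
    refine ContinuousLinearMap.ext fun s => funext fun i => ?_
    change -((↑u⁻¹ : R) * (-(interaction n s)) * (↑u⁻¹ : R)) 1 i = _
    have h3 : (↑u⁻¹ : R) = (n : ℝ)⁻¹ • 1 := rfl
    -- At w = 1 each pair contributes w_i + w_j = 2, the source of the 2 in 2/n.
    have h4 : interaction n s 1 i = 2 * incidenceCLM n s i := by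
      rw [interaction_apply, incidenceCLM_apply, Finset.mul_sum]
      exact Finset.sum_congr rfl fun p _ => by simp; ring
    simp [h3, h4]
    field_simp
  refine ⟨fun s i => Real.log (w s i), ?_, ?_, ?_⟩
  · refine hasFDerivAt_pi'.2 fun i => ?_
    have h1 := (hasFDerivAt_pi'.1 hw i).log (by simp [hw0, hn'.ne'])
    refine h1.congr_fderiv ?_
    ext s
    simp [hw0]
    field_simp
  · ext i
    simp [hw0]
  · have hpos : ∀ᶠ s in 𝓝 0, ∀ i, 0 < w s i := by
      refine eventually_all.2 fun i => ?_
      have := ((continuous_apply i).continuousAt.comp hw.continuousAt).eventually_const_lt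
        (u := 0) (by simp [hw0, hn'])
      exact this
    have hunit : ∀ᶠ s in 𝓝 0, IsUnit (B s) :=
      hB.continuousAt.eventually_mem (Units.isOpen.mem_nhds (by rw [hB0]; exact u.isUnit))
    have hne : ∀ᶠ s in 𝓝 0, ∀ i, incidenceCLM n s i ≠ n := by
      refine eventually_all.2 fun i => ?_
      have h1 : ContinuousAt (fun s => incidenceCLM n s i) 0 := by fun_prop
      exact h1.eventually_ne (by simpa using hn'.ne)
    filter_upwards [hpos, hunit, hne] with s h1 h2 h3 k hk v
    have hexp : (fun i => Real.exp (Real.log (w s i))) = w s := by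
      ext i
      rw [Real.exp_log (h1 i)]
    rw [hexp, isInfluenceWeight_perturbedMatrix_iff hk h3]
    have heq (v : Fin n → ℝ) :
        (∀ i, n * v i - ∑ p, incidence n i p * (s p * (v p.1.1 + v p.1.2)) = 1) ↔ v = w s := by
      have hv : (∀ i, n * v i - ∑ p, incidence n i p * (s p * (v p.1.1 + v p.1.2)) = 1) ↔
          B s v = 1 := by
        rw [funext_iff]
        rfl
      rw [hv]
      constructor
      · intro h
        have h4 := congrArg (fun A : R => A v) (Ring.inverse_mul_cancel _ h2)
        simpa [mul_apply_eq_comp, h] using h4.symm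
      · rintro rfl
        exact congrArg (fun A : R => A 1) (Ring.mul_inverse_cancel _ h2)
    rw [heq]
    refine ⟨fun h => h.2.2, fun h => ⟨fun i => h ▸ (h1 i).le, ?_, h⟩⟩
    -- Total mass one is automatic: the columns of F sum to zero, so adding the n equations gives n
    -- ∑ w = n.
    have h5 := Finset.sum_congr rfl fun i (_ : i ∈ Finset.univ) => (heq v).2 h i
    rw [Finset.sum_sub_distrib, sum_incidence_mul, ← Finset.mul_sum] at h5
    simp only [sub_zero, Finset.sum_const, Finset.card_univ, Fintype.card_fin, nsmul_eq_mul,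
      mul_one] at h5
    exact mul_left_cancel₀ hn'.ne' (by rw [h5, mul_one])

/-! ### The likelihood -/

lemma binomial_sigmoid_real_singleton {N m : ℕ} (hm : m ≤ N) (d : ℝ) :
    (binomial N (unitInterval.sigmoid d)).real {m} =
      N.choose m * Real.exp (m * d - N * Real.log (1 + Real.exp d)) := by
  have h0 : 0 < 1 + Real.exp d := by positivity
  have h1 : (unitInterval.sigmoid d : ℝ) = Real.exp d * (1 + Real.exp d)⁻¹ := by
    change Real.sigmoid d = _
    rw [Real.sigmoid_def, Real.exp_neg]
    field_simp
    ring
  have h2 : 1 - (unitInterval.sigmoid d : ℝ) = (1 + Real.exp d)⁻¹ := by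
    rw [h1]
    field_simp
    ring
  rw [binomial_real_singleton, h2, h1, Real.exp_sub, Real.exp_nat_mul, Real.exp_nat_mul,
    Real.exp_log h0, mul_assoc, mul_pow, mul_assoc, ← pow_add, Nat.add_sub_cancel' hm, inv_pow,
    div_eq_mul_inv]

/-- The log-likelihood up to an additive constant. -/
def logKernel (k : ℕ) (x : Pair n → ℕ) (ν : Fin n → ℝ) : ℝ :=
  ∑ p : Pair n, ((x p : ℝ) * (ν p.1.1 - ν p.1.2) -
    2 * k * Real.log (1 + Real.exp (ν p.1.1 - ν p.1.2)))

lemma likelihood_eq {k : ℕ} {x : Pair n → ℕ} (hx : ∀ p, x p ≤ 2 * k) (ν : Fin n → ℝ) :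
    likelihood n k x ν = (∏ p, ((2 * k).choose (x p) : ℝ)) * Real.exp (logKernel k x ν) := by
  have h : likelihood n k x ν = ∏ p : Pair n,
      (binomial (2 * k) (unitInterval.sigmoid (ν p.1.1 - ν p.1.2))).real {x p} := by
    simp only [likelihood, tournamentLaw, measureReal_def, Measure.pi_singleton,
      ENNReal.toReal_prod]
  rw [h, logKernel, Real.exp_sum, ← Finset.prod_mul_distrib]
  refine Finset.prod_congr rfl fun p _ => ?_
  rw [binomial_sigmoid_real_singleton (hx p)]
  push_cast
  rfl

lemma choose_prod_pos {k : ℕ} {x : Pair n → ℕ} (hx : ∀ p, x p ≤ 2 * k) :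
    0 < ∏ p, ((2 * k).choose (x p) : ℝ) :=
  Finset.prod_pos fun p _ => by exact_mod_cast Nat.choose_pos (hx p)

/-- Strict tangent-line inequality for the log-partition function. Strict convexity of exp between 0
and e - d, with weight σ(d) on the latter, gives it after taking logarithms. -/
lemma log_one_add_exp_lt {d e : ℝ} (h : e ≠ d) :
    Real.log (1 + Real.exp d) + Real.sigmoid d * (e - d) < Real.log (1 + Real.exp e) := by
  have h0 : 0 < 1 + Real.exp d := by positivity
  have h1 := strictConvexOn_exp.2 (Set.mem_univ 0) (Set.mem_univ (e - d)) (sub_ne_zero.2 h).symm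
    (sub_pos.2 (Real.sigmoid_lt_one d)) (Real.sigmoid_pos d) (by ring)
  simp only [smul_eq_mul, mul_zero, zero_add, Real.exp_zero, mul_one] at h1
  have h2 : 1 - Real.sigmoid d + Real.sigmoid d * Real.exp (e - d) =
      (1 + Real.exp e) / (1 + Real.exp d) := by
    rw [Real.sigmoid_def, Real.exp_neg, Real.exp_sub]
    field_simp
    ring
  rw [h2, lt_div_iff₀ h0] at h1
  have h3 := Real.log_lt_log (by positivity) h1
  rw [Real.log_mul (Real.exp_ne_zero _) h0.ne', Real.log_exp] at h3
  linarith

lemma sum_mul_sub_eq (g : Pair n → ℝ) (v : Fin n → ℝ) :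
    ∑ p : Pair n, g p * (v p.1.1 - v p.1.2) = ∑ i, v i * ∑ p, incidence n i p * g p := by
  simp only [← incidence_transpose_mulVec, Matrix.mulVec, dotProduct, Matrix.transpose_apply,
    Finset.mul_sum]
  rw [Finset.sum_comm]
  exact Finset.sum_congr rfl fun _ _ => Finset.sum_congr rfl fun _ _ => by ring

/-- Summing the tangent-line inequality over pairs, the first-order terms add up to the pairing of ν
- ν₀ with the score at ν₀, which is zero. -/
lemma logKernel_lt {k : ℕ} (hk : 0 < k) {x : Pair n → ℕ} {ν₀ ν : Fin n → ℝ}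
    (h : ∀ i, ∑ p : Pair n, incidence n i p *
      (x p - 2 * k * Real.sigmoid (ν₀ p.1.1 - ν₀ p.1.2)) = 0)
    (hν : ∃ p : Pair n, ν p.1.1 - ν p.1.2 ≠ ν₀ p.1.1 - ν₀ p.1.2) :
    logKernel k x ν < logKernel k x ν₀ := by
  have hk' : (0 : ℝ) < 2 * k := by positivity
  have h1 := sum_mul_sub_eq
    (fun p : Pair n => x p - 2 * k * Real.sigmoid (ν₀ p.1.1 - ν₀ p.1.2)) (ν - ν₀)
  simp only [h, mul_zero, Finset.sum_const_zero] at h1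
  rw [← sub_neg, ← h1, logKernel, logKernel, ← Finset.sum_sub_distrib]
  have key (p : Pair n) (hp : ν p.1.1 - ν p.1.2 ≠ ν₀ p.1.1 - ν₀ p.1.2) :=
    mul_lt_mul_of_pos_left (log_one_add_exp_lt hp) hk'
  refine Finset.sum_lt_sum (fun p _ => ?_) ?_
  · by_cases hp : ν p.1.1 - ν p.1.2 = ν₀ p.1.1 - ν₀ p.1.2
    · simp only [hp, Pi.sub_apply]
      have : ν p.1.1 - ν₀ p.1.1 - (ν p.1.2 - ν₀ p.1.2) = 0 := by linarith
      simp [this]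
    · have := key p hp
      simp only [Pi.sub_apply]
      nlinarith
  · obtain ⟨p, hp⟩ := hν
    refine ⟨p, Finset.mem_univ _, ?_⟩
    have := key p hp
    simp only [Pi.sub_apply]
    nlinarith

/-- A root of the likelihood equations is a global maximizer. Any other maximizer has the same
pairwise differences, and the normalization removes the remaining common shift. -/
lemma isMLE_iff {k : ℕ} (hk : 0 < k) {x : Pair n → ℕ} (hx : ∀ p, x p ≤ 2 * k) {ν₀ : Fin n → ℝ}
    (h1 : ∑ i, Real.exp (ν₀ i) = 1)
    (h : ∀ i, ∑ p : Pair n, incidence n i p *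
      (x p - 2 * k * Real.sigmoid (ν₀ p.1.1 - ν₀ p.1.2)) = 0) (ν : Fin n → ℝ) :
    IsMLE n k x ν ↔ ν = ν₀ := by
  constructor
  · rintro ⟨h2, h3⟩
    have h4 : ∀ p : Pair n, ν p.1.1 - ν p.1.2 = ν₀ p.1.1 - ν₀ p.1.2 := by
      by_contra! hne
      have h5 := h3 ν₀
      rw [likelihood_eq hx, likelihood_eq hx, mul_le_mul_iff_right₀ (choose_prod_pos hx),
        Real.exp_le_exp] at h5
      exact absurd h5 (logKernel_lt hk h hne).not_ge
    have h5 (i j : Fin n) : ν i - ν j = ν₀ i - ν₀ j := by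
      rcases lt_trichotomy i j with hij | hij | hij
      · exact h4 ⟨(i, j), hij⟩
      · simp [hij]
      · have := h4 ⟨(j, i), hij⟩
        simp only at this
        linarith
    ext i
    have h6 : ∑ j, Real.exp (ν j) = Real.exp (ν i - ν₀ i) * ∑ j, Real.exp (ν₀ j) := by
      rw [Finset.mul_sum]
      refine Finset.sum_congr rfl fun j _ => ?_
      rw [← Real.exp_add]
      congr 1
      linarith [h5 i j]
    rw [h1, h2, mul_one, eq_comm, Real.exp_eq_one_iff] at h6
    linarith
  · rintro rfl
    refine ⟨h1, fun ν' => ?_⟩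
    rw [likelihood_eq hx, likelihood_eq hx, mul_le_mul_iff_right₀ (choose_prod_pos hx),
      Real.exp_le_exp]
    by_cases hne : ∃ p : Pair n, ν' p.1.1 - ν' p.1.2 ≠ ν p.1.1 - ν p.1.2
    · exact (logKernel_lt hk h hne).le
    · push Not at hne
      simp only [logKernel, hne, le_refl]

/-! ### The maximum likelihood estimator near equal abilities -/

/-- The linear map `a • 1 + b • e eᵀ`. -/
def scalarAddConst (n : ℕ) (a b : ℝ) : (Fin n → ℝ) →L[ℝ] (Fin n → ℝ) :=
  ContinuousLinearMap.pi fun i => a • ContinuousLinearMap.proj i +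
    b • ∑ j, ContinuousLinearMap.proj (R := ℝ) (φ := fun _ : Fin n => ℝ) j

lemma scalarAddConst_apply (a b : ℝ) (v : Fin n → ℝ) (i : Fin n) :
    scalarAddConst n a b v i = a * v i + b * ∑ j, v j := by
  simp [scalarAddConst]

lemma scalarAddConst_apply_apply {a b c d : ℝ} (h1 : a * c = 1)
    (h2 : a * d + b * c + n * b * d = 0) (v : Fin n → ℝ) :
    scalarAddConst n a b (scalarAddConst n c d v) = v := by
  ext i
  simp only [scalarAddConst_apply, Finset.sum_add_distrib, ← Finset.mul_sum, Finset.sum_const,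
    Finset.card_univ, Fintype.card_fin, nsmul_eq_mul]
  linear_combination v i * h1 + (∑ j, v j) * h2

/-- The derivative of `scoreEquation` at equal abilities. -/
def scoreEquationDeriv (hn : 0 < n) : (Fin n → ℝ) ≃L[ℝ] (Fin n → ℝ) :=
  have hn' : (n : ℝ) ≠ 0 := by positivity
  -- The derivative is L/2 + eeᵀ/n, since 2σ'(0) = 1/2 and each ability is 1/n. It acts as n/2 on
  -- vectors of sum zero and as 1 on e, which determines the inverse.
  ContinuousLinearEquiv.equivOfInverse (scalarAddConst n (n / 2) (1 / n - 1 / 2))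
    (scalarAddConst n (2 / n) (1 / n - 2 / n ^ 2))
    (scalarAddConst_apply_apply (by field_simp) (by field_simp; ring))
    (scalarAddConst_apply_apply (by field_simp) (by field_simp; ring))

/-- The likelihood equations and the normalization in one map: `scoreEquation ν = F s` says that
`ν` is the maximum likelihood estimator for the relative deviations `s`. -/
def scoreEquation (ν : Fin n → ℝ) : Fin n → ℝ := fun i =>
  ∑ p : Pair n, incidence n i p * (2 * Real.sigmoid (ν p.1.1 - ν p.1.2) - 1) +
    (∑ j, Real.exp (ν j) - 1)

lemma hasStrictFDerivAt_scoreEquation (hn : 0 < n) :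
    HasStrictFDerivAt scoreEquation (scoreEquationDeriv hn : (Fin n → ℝ) →L[ℝ] (Fin n → ℝ))
      (fun _ => -Real.log n) := by
  have hn' : (0 : ℝ) < n := by positivity
  refine hasStrictFDerivAt_pi'.2 fun i => ?_
  let π (j : Fin n) : (Fin n → ℝ) →L[ℝ] ℝ := ContinuousLinearMap.proj j
  have hσ : HasStrictDerivAt Real.sigmoid (1 / 4) (-Real.log n - -Real.log n) := by
    have h1 := (contDiff_sigmoid.contDiffAt (x := (0 : ℝ))).hasStrictDerivAt (by simp)
    rw [Real.deriv_sigmoid] at h1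
    simp only [Real.sigmoid_zero] at h1
    rw [sub_self, show (1 / 4 : ℝ) = 2⁻¹ * (1 - 2⁻¹) by norm_num]
    exact h1
  have hd (p : Pair n) : HasStrictFDerivAt (fun ν : Fin n → ℝ => ν p.1.1 - ν p.1.2)
      (π p.1.1 - π p.1.2) (fun _ => -Real.log n) := (π p.1.1 - π p.1.2).hasStrictFDerivAt
  have h1 (p : Pair n) := (((hσ.comp_hasStrictFDerivAt (fun _ => -Real.log n) (hd p)).const_mul
    2).sub_const 1).const_mul (incidence n i p)
  have h2 (j : Fin n) : HasStrictFDerivAt (fun ν : Fin n → ℝ => Real.exp (ν j)) _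
    (fun _ => -Real.log n) := ((π j).hasStrictFDerivAt (x := fun _ => -Real.log n)).exp
  have h3 := (HasStrictFDerivAt.fun_sum (u := Finset.univ) fun p _ => h1 p).add
    ((HasStrictFDerivAt.fun_sum (u := Finset.univ) fun j _ => h2 j).sub_const 1)
  refine h3.congr_fderiv ?_
  ext v
  have h4 := sum_incidence_mul_sub v i
  have h5 : ∑ p : Pair n, incidence n i p * (2 * (1 / 4 * (v p.1.1 - v p.1.2))) =
      1 / 2 * (n * v i - ∑ j, v j) := by
    rw [← h4, Finset.mul_sum]
    exact Finset.sum_congr rfl fun _ _ => by ring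
  have h6 : scalarAddConst n (n / 2) (1 / n - 1 / 2) v i =
      1 / 2 * (n * v i - ∑ j, v j) + ∑ j, (n : ℝ)⁻¹ * v j := by
    rw [scalarAddConst_apply, ← Finset.mul_sum]
    ring
  refine Eq.trans ?_ h6.symm
  rw [← h5]
  simp [π, Real.exp_neg, Real.exp_log hn']

/-- The inverse function theorem at equal abilities. F s has sum zero, and there the inverse
derivative is multiplication by 2/n, so the linearization agrees with that of the log influence
weight. -/
theorem exists_mle (hn : 0 < n) :
    ∃ h : (Pair n → ℝ) → (Fin n → ℝ), HasFDerivAt h ((2 / n : ℝ) • incidenceCLM n) 0 ∧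
      (h 0 = fun _ => -Real.log n) ∧
      ∀ᶠ s in 𝓝 0, ∀ k : ℕ, 0 < k → ∀ x, (k : ℝ) • s = deviation n k x → ∀ ν,
        IsMLE n k x ν ↔ ν = h s := by
  have hn' : (0 : ℝ) < n := by positivity
  have hΦ := hasStrictFDerivAt_scoreEquation hn
  have hΦ0 : scoreEquation (fun _ : Fin n => -Real.log n) = 0 := by
    ext i
    simp [scoreEquation, Real.exp_neg, Real.exp_log hn', hn'.ne']
  have hF0 : incidenceCLM n 0 = scoreEquation (fun _ : Fin n => -Real.log n) := by
    rw [hΦ0, map_zero]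
  have hψ := hΦ.to_localInverse.hasFDerivAt
  rw [← hF0] at hψ
  refine ⟨hΦ.localInverse _ _ _ ∘ incidenceCLM n, ?_, ?_, ?_⟩
  · refine (hψ.comp 0 (incidenceCLM n).hasFDerivAt).congr_fderiv ?_
    refine ContinuousLinearMap.ext fun s => funext fun i => ?_
    have h1 : scalarAddConst n (2 / n) (1 / n - 2 / n ^ 2) (incidenceCLM n s) i =
        2 / n * incidenceCLM n s i := by
      have h2 : ∑ j, incidenceCLM n s j = 0 := sum_incidence_mul s
      rw [scalarAddConst_apply, h2, mul_zero, add_zero]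
    exact h1
  · rw [Function.comp_apply, hF0, hΦ.localInverse_apply_image]
  · have h1 : ∀ᶠ s in 𝓝 0, scoreEquation (hΦ.localInverse _ _ _ (incidenceCLM n s)) =
        incidenceCLM n s := by
      have h2 := hΦ.eventually_right_inverse
      rw [← hF0] at h2
      exact (incidenceCLM n).continuous.continuousAt.eventually h2
    -- Here s_p < 1 forces x_p < 2k, as required by the likelihood formula for the data.
    have h2 : ∀ᶠ s : Pair n → ℝ in 𝓝 0, ∀ p, s p < 1 := by
      refine eventually_all.2 fun p => ?_
      exact (continuous_apply p).continuousAt.eventually_lt_const (by simp)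
    filter_upwards [h1, h2] with s h1 h2 k hk x hx ν
    have hk' : (0 : ℝ) < k := by positivity
    have hxs (p : Pair n) : (x p : ℝ) = k * s p + k := by
      have := congrFun hx p
      simp only [Pi.smul_apply, smul_eq_mul, deviation] at this
      linarith
    set ν₀ := hΦ.localInverse _ _ _ (incidenceCLM n s) with hν₀
    have hsum : ∑ i, Real.exp (ν₀ i) = 1 := by
      -- Adding the equations over the players kills both incidence terms and isolates the
      -- normalization; the likelihood equations then hold separately.
      have h3 : ∑ i, (∑ p : Pair n, incidence n i p *
          (2 * Real.sigmoid (ν₀ p.1.1 - ν₀ p.1.2) - 1) + (∑ j, Real.exp (ν₀ j) - 1)) =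
          ∑ i, ∑ p, incidence n i p * s p := Finset.sum_congr rfl fun i _ => congrFun h1 i
      rw [Finset.sum_add_distrib, sum_incidence_mul, sum_incidence_mul, zero_add] at h3
      simp only [Finset.sum_const, Finset.card_univ, Fintype.card_fin, nsmul_eq_mul,
        mul_eq_zero, hn'.ne', false_or] at h3
      linarith
    refine isMLE_iff hk (fun p => ?_) hsum (fun i => ?_) ν
    · have h3 := hxs p
      have h4 := mul_lt_mul_of_pos_left (h2 p) hk'
      have h5 : (x p : ℝ) ≤ (2 * k : ℕ) := by
        push_cast
        linarith
      exact_mod_cast h5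
    · have h3 := congrFun h1 i
      simp only [scoreEquation, hsum, sub_self, add_zero, incidenceCLM_apply] at h3
      have h4 : ∑ p : Pair n, incidence n i p *
          (x p - 2 * k * Real.sigmoid (ν₀ p.1.1 - ν₀ p.1.2)) =
          k * (∑ p, incidence n i p * s p - ∑ p : Pair n,
            incidence n i p * (2 * Real.sigmoid (ν₀ p.1.1 - ν₀ p.1.2) - 1)) := by
        rw [← Finset.sum_sub_distrib, Finset.mul_sum]
        refine Finset.sum_congr rfl fun p _ => ?_
        rw [hxs]
        ring
      rw [h4, h3, sub_self, mul_zero]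

/-! ### The fair binomial distribution -/

/-- The number of wins in `2k` games between equal players. -/
abbrev fairBinomial (k : ℕ) : Measure ℕ := binomial (2 * k) (unitInterval.sigmoid 0)

lemma coe_sigmoid_zero : (unitInterval.sigmoid 0 : ℝ) = 1 / 2 := by
  change Real.sigmoid 0 = _
  rw [Real.sigmoid_zero, one_div]

/-- Reduces the binomial mean and variance to the moment identities of Bernstein polynomials. -/
lemma integral_binomial_eq_sum_bernstein (N : ℕ) (p : unitInterval) (f : ℕ → ℝ) :
    ∫ x, f x ∂binomial N p =
      ∑ m ∈ Finset.range (N + 1), f m * (bernsteinPolynomial ℝ N m).eval (p : ℝ) := by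
  rw [integral_binomial, Nat.range_succ_eq_Iic]
  refine Finset.sum_congr rfl fun m _ => ?_
  simp [bernsteinPolynomial, mul_comm]

lemma integral_binomial_id (N : ℕ) (p : unitInterval) :
    ∫ x, (x : ℝ) ∂binomial N p = N * p := by
  have h := congrArg (Polynomial.eval (p : ℝ)) (bernsteinPolynomial.sum_smul ℝ N)
  rw [Polynomial.eval_finsetSum] at h
  simpa [integral_binomial_eq_sum_bernstein] using h

lemma integral_binomial_sub_mean_sq (N : ℕ) (p : unitInterval) :
    ∫ x, ((x : ℝ) - N * p) ^ 2 ∂binomial N p = N * p * (1 - p) := by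
  have h := congrArg (Polynomial.eval (p : ℝ)) (bernsteinPolynomial.variance ℝ N)
  rw [Polynomial.eval_finsetSum] at h
  rw [integral_binomial_eq_sum_bernstein]
  simp only [Polynomial.eval_mul, Polynomial.eval_pow, Polynomial.eval_sub,
    Polynomial.eval_X, Polynomial.eval_natCast, Polynomial.eval_one, nsmul_eq_mul] at h
  rw [← h]
  exact Finset.sum_congr rfl fun _ _ => by ring

lemma integral_fairBinomial_sub (k : ℕ) : ∫ x, ((x : ℝ) - k) ∂fairBinomial k = 0 := by
  rw [integral_sub (integrable_binomial _) (integrable_const _), integral_binomial_id,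
    coe_sigmoid_zero]
  simp
  ring

lemma integral_fairBinomial_sub_sq (k : ℕ) :
    ∫ x, ((x : ℝ) - k) ^ 2 ∂fairBinomial k = k / 2 := by
  have h := integral_binomial_sub_mean_sq (2 * k) (unitInterval.sigmoid 0)
  rw [coe_sigmoid_zero] at h
  push_cast at h
  convert h using 1
  · congr 1
    ext x
    ring
  · ring

/-- Binomial expansion of cos(b/2)^(2k), with cos(b/2) the average of exp(±ib/2): each game
contributes ±1/2 to the centred count. -/
lemma integral_exp_fairBinomial (k : ℕ) (b : ℝ) :
    ∫ x, Complex.exp ((b * ((x : ℝ) - k) : ℝ) * Complex.I) ∂fairBinomial k =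
      ((Real.cos (b / 2) ^ (2 * k) : ℝ) : ℂ) := by
  rw [integral_binomial, ← Nat.range_succ_eq_Iic, coe_sigmoid_zero]
  have h : ((Real.cos (b / 2) : ℝ) : ℂ) =
      1 / 2 * Complex.exp ((b / 2 : ℝ) * Complex.I) +
        1 / 2 * Complex.exp (-(b / 2 : ℝ) * Complex.I) := by
    rw [Complex.ofReal_cos, Complex.cos]
    ring
  rw [Complex.ofReal_pow, h, add_pow]
  refine Finset.sum_congr rfl fun m hm => ?_
  have hm' : m ≤ 2 * k := Nat.lt_succ_iff.1 (Finset.mem_range.1 hm)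
  have h2 : Complex.exp ((b * ((m : ℝ) - k) : ℝ) * Complex.I) =
      Complex.exp ((b / 2 : ℝ) * Complex.I) ^ m *
        Complex.exp (-(b / 2 : ℝ) * Complex.I) ^ (2 * k - m) := by
    rw [← Complex.exp_nat_mul, ← Complex.exp_nat_mul, ← Complex.exp_add, Nat.cast_sub hm']
    congr 1
    push_cast
    ring
  rw [h2, mul_pow, mul_pow, Complex.real_smul]
  push_cast
  ring

/-- Write cos² = 1 - sin²; then k sin²(a/(2√k)) → a²/4 by the limit of sinc at 0, and (1 + x_k/k)^k
→ exp(lim x_k). -/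
lemma tendsto_cos_pow (a : ℝ) :
    Tendsto (fun k : ℕ => Real.cos ((√(k : ℝ))⁻¹ * a / 2) ^ (2 * k)) atTop
      (𝓝 (Real.exp (-(a ^ 2 / 4)))) := by
  have h0 : Tendsto (fun k : ℕ => (√(k : ℝ))⁻¹ * a / 2) atTop (𝓝 0) := by
    have h1 : Tendsto (fun k : ℕ => (√(k : ℝ))⁻¹) atTop (𝓝 0) :=
      tendsto_inv_atTop_zero.comp (Real.tendsto_sqrt_atTop.comp tendsto_natCast_atTop_atTop)
    simpa using (h1.mul_const a).div_const 2
  have hsinc := (Real.continuous_sinc.tendsto 0).comp h0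
  rw [Real.sinc_zero] at hsinc
  have h2 : Tendsto (fun k : ℕ => (k : ℝ) * -Real.sin ((√(k : ℝ))⁻¹ * a / 2) ^ 2) atTop
      (𝓝 (-(a ^ 2 / 4))) := by
    have h3 := (hsinc.pow 2).const_mul (-(a ^ 2 / 4))
    rw [one_pow, mul_one] at h3
    refine h3.congr' ?_
    filter_upwards [eventually_gt_atTop 0] with k hk
    have hk' : (0 : ℝ) < √(k : ℝ) := by positivity
    rcases eq_or_ne a 0 with rfl | ha
    · simp
    rw [Function.comp_apply, Real.sinc_of_ne_zero (by positivity)]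
    conv_rhs => rw [← Real.sq_sqrt (Nat.cast_nonneg k : (0 : ℝ) ≤ k)]
    simp only [Real.sqrt_sq hk'.le]
    field_simp
    norm_num
  refine (Real.tendsto_one_add_pow_exp_of_tendsto h2).congr fun k => ?_
  rw [pow_mul, Real.cos_sq']
  ring_nf

/-! ### The law of the deviations for equal abilities -/

lemma tournamentLaw_eq {μ : Fin n → ℝ} (hμ : ∀ i j, μ i = μ j) (k : ℕ) :
    tournamentLaw n k μ = Measure.pi fun _ : Pair n => fairBinomial k := by
  unfold tournamentLaw
  congr 1
  ext1 p
  rw [hμ p.1.1 p.1.2, sub_self]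

lemma integral_eval {μ : Fin n → ℝ} (hμ : ∀ i j, μ i = μ j) (k : ℕ) (f : ℕ → ℝ) (p : Pair n) :
    ∫ x, f (x p) ∂tournamentLaw n k μ = ∫ m, f m ∂fairBinomial k := by
  rw [tournamentLaw_eq hμ]
  exact integral_comp_eval (μ := fun _ : Pair n => fairBinomial k)
    (Measurable.of_discrete).aestronglyMeasurable

lemma integrable_eval {μ : Fin n → ℝ} (hμ : ∀ i j, μ i = μ j) (k : ℕ) (f : ℕ → ℝ) (p : Pair n) :
    Integrable (fun x => f (x p)) (tournamentLaw n k μ) := by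
  rw [tournamentLaw_eq hμ]
  exact (measurePreserving_eval (fun _ : Pair n => fairBinomial k) p).integrable_comp_of_integrable
    (integrable_binomial f)

lemma integral_deviation {μ : Fin n → ℝ} (hμ : ∀ i j, μ i = μ j) (k : ℕ) (p : Pair n) :
    ∫ x, deviation n k x p ∂tournamentLaw n k μ = 0 :=
  (integral_eval hμ k (fun m => (m : ℝ) - k) p).trans (integral_fairBinomial_sub k)

lemma integral_deviation_sq {μ : Fin n → ℝ} (hμ : ∀ i j, μ i = μ j) (k : ℕ) (p : Pair n) :
    ∫ x, deviation n k x p ^ 2 ∂tournamentLaw n k μ = k / 2 :=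
  (integral_eval hμ k (fun m => ((m : ℝ) - k) ^ 2) p).trans (integral_fairBinomial_sub_sq k)

lemma indepFun_deviation {μ : Fin n → ℝ} (hμ : ∀ i j, μ i = μ j) (k : ℕ) {p q : Pair n}
    (hpq : p ≠ q) :
    IndepFun (fun x => deviation n k x p) (fun x => deviation n k x q) (tournamentLaw n k μ) := by
  rw [tournamentLaw_eq hμ]
  exact (iIndepFun_pi (μ := fun _ : Pair n => fairBinomial k) (X := fun _ m => (m : ℝ) - k)
    fun _ => Measurable.of_discrete.aemeasurable).indepFun hpq

lemma integrable_deviation_mul {μ : Fin n → ℝ} (hμ : ∀ i j, μ i = μ j) (k : ℕ) (p q : Pair n) :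
    Integrable (fun x => deviation n k x p * deviation n k x q) (tournamentLaw n k μ) := by
  by_cases hpq : p = q
  · subst hpq
    exact integrable_eval hμ k (fun m => ((m : ℝ) - k) * ((m : ℝ) - k)) p
  · exact (indepFun_deviation hμ k hpq).integrable_mul
      (integrable_eval hμ k (fun m => (m : ℝ) - k) p)
      (integrable_eval hμ k (fun m => (m : ℝ) - k) q)

lemma integral_deviation_mul {μ : Fin n → ℝ} (hμ : ∀ i j, μ i = μ j) (k : ℕ) (p q : Pair n) :
    ∫ x, deviation n k x p * deviation n k x q ∂tournamentLaw n k μ =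
      if p = q then (k : ℝ) / 2 else 0 := by
  split_ifs with hpq
  · subst hpq
    rw [← integral_deviation_sq hμ k p]
    simp only [sq]
  · rw [(indepFun_deviation hμ k hpq).integral_fun_mul_eq_mul_integral
      (Measurable.of_discrete.aestronglyMeasurable) (Measurable.of_discrete.aestronglyMeasurable),
      integral_deviation hμ, zero_mul]

/-- Markov's inequality for the sum of squared deviations, whose mean is k/2 per pair. -/
lemma measureReal_le_norm_deviation {μ : Fin n → ℝ} (hμ : ∀ i j, μ i = μ j) (k : ℕ) {r : ℝ}
    (hr : 0 < r) :
    (tournamentLaw n k μ).real {x | r ≤ ‖deviation n k x‖} ≤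
      Fintype.card (Pair n) * k / 2 / r ^ 2 := by
  have hint (p : Pair n) : Integrable (fun x => deviation n k x p ^ 2) (tournamentLaw n k μ) :=
    integrable_eval hμ k (fun m => ((m : ℝ) - k) ^ 2) p
  have h := mul_meas_ge_le_integral_of_nonneg (μ := tournamentLaw n k μ)
    (f := fun x => ∑ p, deviation n k x p ^ 2)
    (ae_of_all _ fun x => Finset.sum_nonneg fun p _ => sq_nonneg _)
    (integrable_finsetSum _ fun p _ => hint p) (r ^ 2)
  rw [integral_finsetSum _ fun p _ => hint p] at h
  simp only [integral_deviation_sq hμ, Finset.sum_const, Finset.card_univ, nsmul_eq_mul] at h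
  rw [le_div_iff₀ (by positivity), mul_comm, mul_div_assoc]
  refine le_trans (mul_le_mul_of_nonneg_left (measureReal_mono fun x hx => ?_) (by positivity)) h
  have h1 : ∃ p, r ≤ |deviation n k x p| := by
    by_contra! hlt
    exact absurd hx (not_le.2 ((pi_norm_lt_iff hr).2 hlt))
  obtain ⟨p, hp⟩ := h1
  calc r ^ 2 ≤ |deviation n k x p| ^ 2 := by gcongr
    _ = deviation n k x p ^ 2 := sq_abs _
    _ ≤ _ := Finset.single_le_sum (f := fun p => deviation n k x p ^ 2)
      (fun p _ => sq_nonneg _) (Finset.mem_univ p)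

/-- Weak law of large numbers: the relative deviations enter any neighbourhood of 0 with probability
tending to 1. -/
lemma tendsto_measureReal_of_eventually {μ : Fin n → ℝ} (hμ : ∀ i j, μ i = μ j)
    {U : (Pair n → ℝ) → Prop} (hU : ∀ᶠ s in 𝓝 0, U s) :
    Tendsto (fun k : ℕ => (tournamentLaw n k μ).real {x | U ((k : ℝ)⁻¹ • deviation n k x)}) atTop
      (𝓝 1) := by
  obtain ⟨δ, hδ, h⟩ := Metric.eventually_nhds_iff.1 hU
  have h1 : Tendsto (fun k : ℕ => 1 - Fintype.card (Pair n) / (2 * δ ^ 2) * (k : ℝ)⁻¹) atTop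
      (𝓝 1) := by
    simpa using (tendsto_inv_atTop_nhds_zero_nat (𝕜 := ℝ)).const_mul
      ((Fintype.card (Pair n) : ℝ) / (2 * δ ^ 2)) |>.const_sub 1
  refine tendsto_of_tendsto_of_tendsto_of_le_of_le' h1 tendsto_const_nhds ?_
    (Eventually.of_forall fun k => measureReal_le_one)
  filter_upwards [eventually_gt_atTop 0] with k hk
  have hk' : (0 : ℝ) < k := by positivity
  have h2 := measureReal_le_norm_deviation hμ k (mul_pos hk' hδ)
  have h3 : {x | k * δ ≤ ‖deviation n k x‖}ᶜ ⊆ {x | U ((k : ℝ)⁻¹ • deviation n k x)} := by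
    intro x hx
    refine h ?_
    rw [dist_zero_right, norm_smul, norm_inv, Real.norm_natCast, inv_mul_lt_iff₀ hk']
    exact not_le.1 hx
  refine le_trans ?_ (measureReal_mono h3)
  rw [probReal_compl_eq_one_sub .of_discrete]
  refine sub_le_sub_left (h2.trans (le_of_eq ?_)) 1
  field_simp

/-! ### Convergence of characteristic functions -/

/-- Slutsky's argument for characteristic functions, with a probability measure that varies with k.
The integrands differ by at most ε‖t‖ where the variables are ε-close, and by at most 2 elsewhere.
-/
lemma tendsto_integral_exp_of_tendsto_sub {Ω E : Type*} [MeasurableSpace Ω]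
    {P : ℕ → Measure Ω} [∀ k, IsProbabilityMeasure (P k)] [NormedAddCommGroup E]
    [InnerProductSpace ℝ E] [MeasurableSpace E] [BorelSpace E] [SecondCountableTopology E]
    {X Y : ℕ → Ω → E} (hX : ∀ k, Measurable (X k)) (hY : ∀ k, Measurable (Y k))
    (h : ∀ ε > 0, Tendsto (fun k => (P k).real {ω | ε ≤ ‖Y k ω - X k ω‖}) atTop (𝓝 0))
    {t : E} {c : ℂ}
    (hc : Tendsto (fun k => ∫ ω, Complex.exp (inner ℝ (X k ω) t * Complex.I) ∂P k) atTop (𝓝 c)) :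
    Tendsto (fun k => ∫ ω, Complex.exp (inner ℝ (Y k ω) t * Complex.I) ∂P k) atTop (𝓝 c) := by
  have hexp (Z : ℕ → Ω → E) (hZ : ∀ k, Measurable (Z k)) (k : ℕ) :
      Integrable (fun ω => Complex.exp (inner ℝ (Z k ω) t * Complex.I)) (P k) := by
    have hm := hZ k
    refine Integrable.of_bound (by fun_prop) 1 (ae_of_all _ fun ω => ?_)
    rw [Complex.norm_exp_ofReal_mul_I]
  have hbound (ε : ℝ) (hε : 0 < ε) (k : ℕ) :
      ‖∫ ω, Complex.exp (inner ℝ (Y k ω) t * Complex.I) ∂P k -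
        ∫ ω, Complex.exp (inner ℝ (X k ω) t * Complex.I) ∂P k‖ ≤
        ε * ‖t‖ + 2 * (P k).real {ω | ε ≤ ‖Y k ω - X k ω‖} := by
    have hmeas : MeasurableSet {ω | ε ≤ ‖Y k ω - X k ω‖} := by
      have h1 := hX k
      have h2 := hY k
      exact measurableSet_le measurable_const (by fun_prop)
    rw [← integral_sub (hexp Y hY k) (hexp X hX k)]
    have h1 : Integrable (fun ω => ε * ‖t‖ +
        {ω | ε ≤ ‖Y k ω - X k ω‖}.indicator (fun _ => (2 : ℝ)) ω) (P k) :=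
      (integrable_const _).add ((integrable_const _).indicator hmeas)
    refine (norm_integral_le_of_norm_le h1 (ae_of_all _ fun ω => ?_)).trans (le_of_eq ?_)
    · by_cases hω : ε ≤ ‖Y k ω - X k ω‖
      · rw [Set.indicator_of_mem (by exact hω)]
        refine (norm_sub_le _ _).trans ?_
        rw [Complex.norm_exp_ofReal_mul_I, Complex.norm_exp_ofReal_mul_I]
        have : 0 ≤ ε * ‖t‖ := by positivity
        linarith
      · rw [Set.indicator_of_notMem (by exact hω), add_zero]
        have h2 : Complex.exp (inner ℝ (Y k ω) t * Complex.I) -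
            Complex.exp (inner ℝ (X k ω) t * Complex.I) =
            Complex.exp (inner ℝ (X k ω) t * Complex.I) *
              (Complex.exp (Complex.I * (inner ℝ (Y k ω - X k ω) t : ℝ)) - 1) := by
          rw [mul_sub, ← Complex.exp_add, mul_one, inner_sub_left]
          congr 2
          push_cast
          ring
        rw [h2, norm_mul, Complex.norm_exp_ofReal_mul_I, one_mul]
        refine Real.norm_exp_I_mul_ofReal_sub_one_le.trans ((norm_inner_le_norm _ _).trans ?_)
        gcongr
        exact (not_le.1 hω).le
    · rw [integral_add (integrable_const _) ((integrable_const _).indicator hmeas),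
        integral_indicator_const _ hmeas]
      simp [mul_comm]
  have hsub : Tendsto (fun k => ∫ ω, Complex.exp (inner ℝ (Y k ω) t * Complex.I) ∂P k -
      ∫ ω, Complex.exp (inner ℝ (X k ω) t * Complex.I) ∂P k) atTop (𝓝 0) := by
    rw [tendsto_zero_iff_norm_tendsto_zero, Metric.tendsto_atTop']
    intro γ hγ
    have hε : 0 < γ / (2 * (‖t‖ + 1)) := by positivity
    have hε' : γ / (2 * (‖t‖ + 1)) * ‖t‖ < γ / 2 := by
      rw [div_mul_eq_mul_div, div_lt_div_iff₀ (by positivity) (by positivity)]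
      nlinarith [norm_nonneg t]
    obtain ⟨K, hK⟩ := eventually_atTop.1
      ((h _ hε).eventually_lt_const (show (0 : ℝ) < γ / 4 by positivity))
    refine ⟨K, fun k hk => ?_⟩
    rw [dist_zero_right, norm_norm]
    have h1 := hbound _ hε k
    have h2 := hK k hk.le
    linarith
  simpa using hsub.add hc

/-! ### The delta method -/

lemma integral_exp_deviation {μ : Fin n → ℝ} (hμ : ∀ i j, μ i = μ j) (k : ℕ) (a : Pair n → ℝ) :
    ∫ x, Complex.exp ((∑ p, a p * deviation n k x p : ℝ) * Complex.I) ∂tournamentLaw n k μ =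
      ((∏ p, Real.cos (a p / 2) ^ (2 * k) : ℝ) : ℂ) := by
  rw [tournamentLaw_eq hμ, Complex.ofReal_prod]
  simp only [← integral_exp_fairBinomial]
  rw [← integral_fintype_prod_eq_prod (μ := fun _ : Pair n => fairBinomial k)
    (f := fun p (m : ℕ) => Complex.exp ((a p * ((m : ℝ) - k) : ℝ) * Complex.I))]
  refine integral_congr_ae (ae_of_all _ fun x => ?_)
  simp only [deviation]
  rw [← Complex.exp_sum, Complex.ofReal_sum, Finset.sum_mul]

/-- The linear part of the estimators, with values in Euclidean space. -/
def linearPart (n : ℕ) : (Pair n → ℝ) →L[ℝ] EuclideanSpace ℝ (Fin n) :=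
  ((PiLp.continuousLinearEquiv 2 ℝ fun _ : Fin n => ℝ).symm :
    (Fin n → ℝ) →L[ℝ] EuclideanSpace ℝ (Fin n)) ∘L ((2 / n : ℝ) • incidenceCLM n)

lemma inner_linearPart (c : ℝ) (s : Pair n → ℝ) (t : EuclideanSpace ℝ (Fin n)) :
    inner ℝ (c • linearPart n s) t = ∑ p : Pair n, c * (2 / n * (t p.1.1 - t p.1.2)) * s p := by
  have h1 : inner ℝ (c • linearPart n s) t =
      c * (2 / n * ∑ i, t i * ∑ p, incidence n i p * s p) := by
    rw [real_inner_smul_left, PiLp.inner_apply, Finset.mul_sum (a := (2 / n : ℝ))]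
    refine congrArg (c * ·) (Finset.sum_congr rfl fun i _ => ?_)
    change t i * (2 / n * incidenceCLM n s i) = _
    rw [incidenceCLM_apply]
    ring
  rw [h1, ← sum_mul_sub_eq, Finset.mul_sum, Finset.mul_sum]
  exact Finset.sum_congr rfl fun p _ => by ring

lemma dotProduct_laplacian (t : Fin n → ℝ) :
    dotProduct t ((laplacian n).mulVec t) = ∑ p : Pair n, (t p.1.1 - t p.1.2) ^ 2 := by
  have h := sum_mul_sub_eq (fun p : Pair n => t p.1.1 - t p.1.2) t
  simp only [sum_incidence_mul_sub, ← laplacian_mulVec] at h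
  rw [dotProduct, ← h]
  exact Finset.sum_congr rfl fun p _ => by ring

/-- Independence gives a product of cosine powers with frequencies a_p = (2/n)(t_i - t_j). The
limiting exponent -∑ a_p²/4 equals -tᵀ((2/n²)L)t/2. -/
lemma tendsto_integral_exp_linearPart {μ : Fin n → ℝ} (hμ : ∀ i j, μ i = μ j)
    (t : EuclideanSpace ℝ (Fin n)) :
    Tendsto (fun k : ℕ => ∫ x, Complex.exp
      (inner ℝ ((√(k : ℝ))⁻¹ • linearPart n (deviation n k x)) t * Complex.I) ∂tournamentLaw n k μ)
      atTop (𝓝 (charFun (multivariateGaussian 0 ((2 / (n : ℝ) ^ 2) • laplacian n)) t)) := by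
  have hS : ((2 / (n : ℝ) ^ 2) • laplacian n).PosSemidef :=
    laplacian_posSemidef.smul (by positivity)
  have h1 : charFun (multivariateGaussian 0 ((2 / (n : ℝ) ^ 2) • laplacian n)) t =
      ((∏ p : Pair n, Real.exp (-((2 / n * (t p.1.1 - t p.1.2)) ^ 2 / 4)) : ℝ) : ℂ) := by
    rw [charFun_multivariateGaussian hS, ← Real.exp_sum, Complex.ofReal_exp]
    congr 1
    rw [Matrix.smul_mulVec, dotProduct_smul, dotProduct_laplacian, Finset.sum_neg_distrib,
      ← Finset.sum_div]
    simp only [mul_pow, ← Finset.mul_sum, inner_zero_right]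
    push_cast
    simp only [smul_eq_mul]
    push_cast
    ring
  rw [h1]
  simp only [inner_linearPart, integral_exp_deviation hμ]
  refine (Complex.continuous_ofReal.tendsto _).comp ?_
  exact tendsto_finsetProd _ fun p _ => tendsto_cos_pow _

lemma normalizedLogAbility_eq (hn : 0 < n) {μ : Fin n → ℝ} (hμ : ∀ i j, μ i = μ j) :
    normalizedLogAbility μ = fun _ => -Real.log n := by
  ext i
  have h1 : ∑ j, Real.exp (μ j) = n * Real.exp (μ i) := by
    rw [Finset.sum_congr rfl fun j _ => by rw [hμ j i]]
    simp
  have h2 : (n : ℝ) ≠ 0 := by positivity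
  rw [normalizedLogAbility, h1, Real.log_mul h2 (Real.exp_ne_zero _), Real.log_exp]
  ring

/-- The delta method for any estimator that agrees with h near s = 0. Its values elsewhere,
including default values, matter only on events of vanishing probability. -/
theorem tendstoInDistribution_estimator (hn : 0 < n) {μ : Fin n → ℝ} (hμ : ∀ i j, μ i = μ j)
    {T : ℕ → (Pair n → ℕ) → Fin n → ℝ} {h : (Pair n → ℝ) → (Fin n → ℝ)}
    (hd : HasFDerivAt h ((2 / n : ℝ) • incidenceCLM n) 0) (h0 : h 0 = fun _ => -Real.log n)
    (hT : ∀ᶠ s in 𝓝 0, ∀ k : ℕ, 0 < k → ∀ x, (k : ℝ) • s = deviation n k x → T k x = h s) :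
    TendstoInDistribution
      (fun (k : ℕ) (x : Pair n → ℕ) =>
        √(k : ℝ) • (WithLp.toLp 2 (T k x - normalizedLogAbility μ) : EuclideanSpace ℝ (Fin n)))
      atTop (id : EuclideanSpace ℝ (Fin n) → EuclideanSpace ℝ (Fin n))
      (fun k => tournamentLaw n k μ)
      (multivariateGaussian 0 ((2 / (n : ℝ) ^ 2) • laplacian n)) := by
  refine ⟨fun k => Measurable.of_discrete.aemeasurable, aemeasurable_id, ?_⟩
  refine ProbabilityMeasure.tendsto_of_tendsto_charFun fun t => ?_
  simp only [ProbabilityMeasure.coe_mk, Measure.map_id, charFun_apply]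
  have hmap (k : ℕ) (Z : (Pair n → ℕ) → EuclideanSpace ℝ (Fin n)) :
      ∫ v, Complex.exp (inner ℝ v t * Complex.I) ∂(tournamentLaw n k μ).map Z =
        ∫ x, Complex.exp (inner ℝ (Z x) t * Complex.I) ∂tournamentLaw n k μ :=
    integral_map Measurable.of_discrete.aemeasurable
      (Continuous.aestronglyMeasurable (by fun_prop))
  simp only [hmap]
  refine tendsto_integral_exp_of_tendsto_sub (fun _ => Measurable.of_discrete)
    (fun _ => Measurable.of_discrete) (fun ε hε => ?_) (tendsto_integral_exp_linearPart hμ t)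
  have hg := (PiLp.continuousLinearEquiv 2 ℝ fun _ : Fin n => ℝ).symm.hasFDerivAt.comp 0 hd
  change HasFDerivAt (fun s => (WithLp.toLp 2 (h s) : EuclideanSpace ℝ (Fin n)))
    (linearPart n) 0 at hg
  rw [hasFDerivAt_iff_isLittleO_nhds_zero] at hg
  simp only [zero_add] at hg
  rw [Metric.tendsto_nhds]
  intro γ hγ
  let N : ℝ := Fintype.card (Pair n)
  -- The slope c of the remainder bound is chosen so that the bound on the probability of
  -- ‖deviation‖ ≥ (ε/c)√k, which is free of k, stays below γ/2.
  obtain ⟨c, hc, hc0⟩ : ∃ c : ℝ, N / 2 * (c / ε) ^ 2 < γ / 2 ∧ 0 < c := by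
    have h1 : ContinuousAt (fun c : ℝ => N / 2 * (c / ε) ^ 2) 0 := by fun_prop
    have h2 := h1.eventually_lt_const (u := γ / 2) (by simpa using hγ)
    exact ((h2.filter_mono nhdsWithin_le_nhds).and (self_mem_nhdsWithin (s := Set.Ioi 0))).exists
  let U (s : Pair n → ℝ) : Prop :=
    ‖(WithLp.toLp 2 (h s) : EuclideanSpace ℝ (Fin n)) - WithLp.toLp 2 (h 0) - linearPart n s‖ ≤
      c * ‖s‖ ∧ ∀ k : ℕ, 0 < k → ∀ x, (k : ℝ) • s = deviation n k x → T k x = h s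
  have hU : ∀ᶠ s in 𝓝 0, U s := (hg.bound hc0).and hT
  have hgood := tendsto_measureReal_of_eventually hμ hU
  filter_upwards [hgood.eventually_const_lt (show 1 - γ / 2 < 1 by linarith),
    eventually_gt_atTop 0] with k h1 hk
  have hk' : (0 : ℝ) < √(k : ℝ) := by positivity
  have hk2 : (0 : ℝ) < k := by positivity
  rw [Real.dist_0_eq_abs, abs_of_nonneg measureReal_nonneg]
  have hr : 0 < ε / c * √(k : ℝ) := by positivity
  have h2 := measureReal_le_norm_deviation hμ k hr
  have h3 : N * k / 2 / (ε / c * √(k : ℝ)) ^ 2 = N / 2 * (c / ε) ^ 2 := by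
    rw [mul_pow, Real.sq_sqrt hk2.le]
    field_simp
  set G := {x : Pair n → ℕ | U ((k : ℝ)⁻¹ • deviation n k x)}
  rw [h3] at h2
  have h4 : (tournamentLaw n k μ).real Gᶜ < γ / 2 := by
    rw [probReal_compl_eq_one_sub .of_discrete]
    linarith
  refine lt_of_le_of_lt ((measureReal_mono ?_).trans (measureReal_union_le _ Gᶜ))
    ((add_lt_add_of_le_of_lt (h2.trans hc.le) h4).trans_eq (add_halves γ))
  intro x hx
  by_contra hnot
  simp only [Set.mem_union, Set.mem_compl_iff, not_or, not_not] at hnot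
  obtain ⟨hlt, hlo, hTx⟩ := hnot
  have hkk : (k : ℝ) • ((k : ℝ)⁻¹ • deviation n k x) = deviation n k x := by
    rw [smul_smul, mul_inv_cancel₀ hk2.ne', one_smul]
  have hsq : (√(k : ℝ))⁻¹ = √(k : ℝ) * (k : ℝ)⁻¹ := by
    conv_rhs => rw [← Real.mul_self_sqrt hk2.le]
    simp only [Real.sqrt_mul_self hk'.le]
    field_simp
  have h5 : √(k : ℝ) • (WithLp.toLp 2 (T k x - normalizedLogAbility μ) :
      EuclideanSpace ℝ (Fin n)) - (√(k : ℝ))⁻¹ • linearPart n (deviation n k x) =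
      √(k : ℝ) • (WithLp.toLp 2 (h ((k : ℝ)⁻¹ • deviation n k x)) - WithLp.toLp 2 (h 0) -
        linearPart n ((k : ℝ)⁻¹ • deviation n k x)) := by
    rw [hTx k hk x hkk, normalizedLogAbility_eq hn hμ, ← h0, smul_sub, WithLp.toLp_sub, map_smul,
      smul_smul, ← hsq]
  -- On the good event the remainder is at most c‖deviation‖/√k, so an error of at least ε forces
  -- the large deviation just excluded.
  have h6 : ε ≤ √(k : ℝ) * (c * ((k : ℝ)⁻¹ * ‖deviation n k x‖)) := by
    refine le_trans (le_of_le_of_eq hx (congrArg norm h5)) ?_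
    rw [norm_smul, Real.norm_of_nonneg hk'.le]
    refine mul_le_mul_of_nonneg_left (hlo.trans_eq ?_) hk'.le
    rw [norm_smul, norm_inv, Real.norm_natCast]
  refine hlt ?_
  have h7 : √(k : ℝ) * (c * ((k : ℝ)⁻¹ * ‖deviation n k x‖)) =
      c * ((√(k : ℝ))⁻¹ * ‖deviation n k x‖) := by
    rw [hsq]
    ring
  rw [h7, ← div_le_iff₀' hc0, le_inv_mul_iff₀ hk', mul_comm] at h6
  exact h6

/-! ### Delta-method covariance, Fisher information and the Cramér–Rao bound -/

lemma dataCovariance_eq {μ : Fin n → ℝ} (hμ : ∀ i j, μ i = μ j) (k : ℕ) :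
    dataCovariance n k μ = ((k : ℝ) / 2) • 1 := by
  have hmean (p : Pair n) : ∫ x, (x p : ℝ) ∂tournamentLaw n k μ = k := by
    rw [integral_eval hμ k (fun m => (m : ℝ)) p, integral_binomial_id, coe_sigmoid_zero]
    push_cast
    ring
  ext p q
  simp only [dataCovariance, Matrix.of_apply, covariance, hmean]
  refine (integral_deviation_mul hμ k p q).trans ?_
  simp [Matrix.one_apply]

lemma jacobian_eq_of_hasFDerivAt {ι κ : Type*} [Fintype ι] [DecidableEq ι] [Fintype κ]
    {f : (ι → ℝ) → (κ → ℝ)} {x : ι → ℝ} {f' : (ι → ℝ) →L[ℝ] (κ → ℝ)} (h : HasFDerivAt f f' x)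
    (i : κ) (j : ι) : jacobian f x i j = f' (Pi.single j 1) i := by
  rw [jacobian, h.fderiv, LinearMap.toMatrix'_apply]
  rfl

lemma log_eq_of_isInfluenceWeight {k : ℕ} {t : Pair n → ℝ} {v : Fin n → ℝ}
    (h : ∀ w, IsInfluenceWeight (perturbedMatrix n k t) w ↔ w = fun i => Real.exp (v i)) :
    logInfluenceWeight n k t = v := by
  have hex : ∃ w, IsInfluenceWeight (perturbedMatrix n k t) w := ⟨_, (h _).2 rfl⟩
  ext i
  rw [logInfluenceWeight, influenceWeight, dif_pos hex, (h _).1 hex.choose_spec, Real.log_exp]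

lemma logAbilityMLE_eq {k : ℕ} {x : Pair n → ℕ} {v : Fin n → ℝ}
    (h : ∀ ν, IsMLE n k x ν ↔ ν = v) : logAbilityMLE n k x = v := by
  have hex : ∃ ν, IsMLE n k x ν := ⟨_, (h _).2 rfl⟩
  rw [logAbilityMLE, dif_pos hex, (h _).1 hex.choose_spec]

lemma eventually_influenceWeight {h : (Pair n → ℝ) → (Fin n → ℝ)}
    (hw : ∀ᶠ s in 𝓝 0, ∀ k : ℕ, 0 < k → ∀ w,
      IsInfluenceWeight (perturbedMatrix n k ((k : ℝ) • s)) w ↔ w = fun i => Real.exp (h s i))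
    {k : ℕ} (hk : 0 < k) :
    ∀ᶠ t in 𝓝 (0 : Pair n → ℝ), ∀ w,
      IsInfluenceWeight (perturbedMatrix n k t) w ↔
        w = fun i => Real.exp (h ((k : ℝ)⁻¹ • t) i) := by
  have hk' : (k : ℝ) ≠ 0 := by positivity
  have hc : Tendsto (fun t : Pair n → ℝ => (k : ℝ)⁻¹ • t) (𝓝 0) (𝓝 0) := by
    have : Continuous fun t : Pair n → ℝ => (k : ℝ)⁻¹ • t := by fun_prop
    simpa using this.tendsto 0
  filter_upwards [hc.eventually hw] with t ht
  simpa [smul_smul, mul_inv_cancel₀ hk'] using ht k hk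

lemma existsUnique_influenceWeight (hn : 0 < n) {k : ℕ} (hk : 0 < k) :
    ∀ᶠ t in 𝓝 (0 : Pair n → ℝ), ∃! w, IsInfluenceWeight (perturbedMatrix n k t) w := by
  obtain ⟨h, -, -, hw⟩ := exists_log_influenceWeight hn
  filter_upwards [eventually_influenceWeight hw hk] with t ht
  exact ⟨_, (ht _).2 rfl, fun w => (ht w).1⟩

lemma hasFDerivAt_logInfluenceWeight (hn : 0 < n) {k : ℕ} (hk : 0 < k) :
    HasFDerivAt (logInfluenceWeight n k) (((k : ℝ)⁻¹ * (2 / n)) • incidenceCLM n) 0 := by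
  obtain ⟨h, hd, -, hw⟩ := exists_log_influenceWeight hn
  have h1 : HasFDerivAt (fun t : Pair n → ℝ => (k : ℝ)⁻¹ • t)
      ((k : ℝ)⁻¹ • ContinuousLinearMap.id ℝ _) 0 :=
    ((k : ℝ)⁻¹ • ContinuousLinearMap.id ℝ (Pair n → ℝ)).hasFDerivAt
  have hd' : HasFDerivAt h ((2 / n : ℝ) • incidenceCLM n) ((k : ℝ)⁻¹ • (0 : Pair n → ℝ)) := by
    rwa [smul_zero]
  have h2 := (HasFDerivAt.comp (0 : Pair n → ℝ) hd' h1).congr_of_eventuallyEq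
    ((eventually_influenceWeight hw hk).mono fun t ht => log_eq_of_isInfluenceWeight ht)
  refine h2.congr_fderiv ?_
  rw [ContinuousLinearMap.comp_smul, ContinuousLinearMap.comp_id, smul_smul]

lemma deltaCovariance_eq (hn : 0 < n) {μ : Fin n → ℝ} (hμ : ∀ i j, μ i = μ j) {k : ℕ}
    (hk : 0 < k) : deltaCovariance n k μ = (k : ℝ)⁻¹ • ((2 / (n : ℝ) ^ 2) • laplacian n) := by
  have hJ : jacobian (logInfluenceWeight n k) 0 = ((k : ℝ)⁻¹ * (2 / n)) • incidence n := by
    ext i p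
    rw [jacobian_eq_of_hasFDerivAt (hasFDerivAt_logInfluenceWeight hn hk)]
    simp [incidenceCLM_apply, Pi.single_apply]
  have hk' : (k : ℝ) ≠ 0 := by positivity
  rw [deltaCovariance, hJ, dataCovariance_eq hμ, laplacian]
  simp only [Matrix.transpose_smul, Matrix.smul_mul, Matrix.mul_smul, Matrix.mul_one, smul_smul]
  congr 1
  field_simp

/-- At equal abilities each expected count is 2kσ(0) = k, so the score is F applied to the
deviations. -/
lemma fderiv_log_likelihood {k : ℕ} {x : Pair n → ℕ} (hx : ∀ p, x p ≤ 2 * k) {μ : Fin n → ℝ}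
    (hμ : ∀ i j, μ i = μ j) (i : Fin n) :
    fderiv ℝ (fun ν => Real.log (likelihood n k x ν)) μ (Pi.single i 1) =
      ∑ p, incidence n i p * deviation n k x p := by
  have h1 : (fun ν => Real.log (likelihood n k x ν)) =
      fun ν => Real.log (∏ p, ((2 * k).choose (x p) : ℝ)) + logKernel k x ν := by
    ext ν
    rw [likelihood_eq hx, Real.log_mul (choose_prod_pos hx).ne' (Real.exp_ne_zero _), Real.log_exp]
  let π (j : Fin n) : (Fin n → ℝ) →L[ℝ] ℝ := ContinuousLinearMap.proj j
  have hd (p : Pair n) : HasFDerivAt (fun ν : Fin n → ℝ => ν p.1.1 - ν p.1.2)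
      (π p.1.1 - π p.1.2) μ := (π p.1.1 - π p.1.2).hasFDerivAt
  have h2 : HasFDerivAt (logKernel k x) _ μ := HasFDerivAt.fun_sum (u := Finset.univ) fun p _ =>
    ((hd p).const_mul (x p : ℝ)).sub
      ((((hd p).exp.const_add 1).log (by positivity)).const_mul (2 * k : ℝ))
  rw [h1, (h2.const_add _).fderiv, sum_apply]
  refine Finset.sum_congr rfl fun p _ => ?_
  have h3 : (π p.1.1 - π p.1.2) (Pi.single i 1) = incidence n i p := by
    simp [π, incidence_apply, Pi.single_apply, eq_comm]
  have h4 : μ p.1.1 - μ p.1.2 = 0 := by rw [hμ p.1.1 p.1.2, sub_self]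
  simp only [sub_apply, smul_apply, h4, smul_eq_mul, Real.exp_zero] at h3 ⊢
  rw [h3, deviation]
  ring

lemma ae_le_two_mul (k : ℕ) (μ : Fin n → ℝ) :
    ∀ᵐ x ∂tournamentLaw n k μ, ∀ p, x p ≤ 2 * k := by
  refine ae_all_iff.2 fun p => ?_
  have h1 : HasLaw id (binomial (2 * k) (unitInterval.sigmoid (μ p.1.1 - μ p.1.2)))
      (binomial (2 * k) (unitInterval.sigmoid (μ p.1.1 - μ p.1.2))) := HasLaw.id
  exact (measurePreserving_eval (fun p : Pair n =>
    binomial (2 * k) (unitInterval.sigmoid (μ p.1.1 - μ p.1.2))) p).quasiMeasurePreserving.ae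
      (ae_le_of_hasLaw_binomial h1)

lemma fisherInformation_eq {μ : Fin n → ℝ} (hμ : ∀ i j, μ i = μ j) (k : ℕ) :
    fisherInformation n k μ = ((k : ℝ) / 2) • laplacian n := by
  ext i j
  have h1 : ∫ x, fderiv ℝ (fun ν => Real.log (likelihood n k x ν)) μ (Pi.single i 1) *
      fderiv ℝ (fun ν => Real.log (likelihood n k x ν)) μ (Pi.single j 1) ∂tournamentLaw n k μ =
      ∫ x, ∑ p, ∑ q, incidence n i p * incidence n j q *
        (deviation n k x p * deviation n k x q) ∂tournamentLaw n k μ := by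
    -- The score formula needs x_p ≤ 2k, which holds almost surely.
    refine integral_congr_ae ?_
    filter_upwards [ae_le_two_mul k μ] with x hx
    rw [fderiv_log_likelihood hx hμ, fderiv_log_likelihood hx hμ, Finset.sum_mul_sum]
    exact Finset.sum_congr rfl fun _ _ => Finset.sum_congr rfl fun _ _ => by ring
  have hint (p q : Pair n) := (integrable_deviation_mul hμ k p q).const_mul
    (incidence n i p * incidence n j q)
  rw [fisherInformation, Matrix.of_apply, h1,
    integral_finsetSum _ fun p _ => integrable_finsetSum _ fun q _ => hint p q]
  simp only [integral_finsetSum _ fun q _ => hint _ q, integral_const_mul,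
    integral_deviation_mul hμ, mul_ite, mul_zero, Finset.sum_ite_eq, Finset.mem_univ, if_true]
  rw [← Finset.sum_mul, Matrix.smul_apply, laplacian, Matrix.mul_apply, smul_eq_mul, mul_comm]
  rfl

/-- At equal abilities D = I - eeᵀ/n, and the columns of L sum to zero. -/
lemma jacobian_normalizedLogAbility_mul_laplacian (hn : 0 < n) {μ : Fin n → ℝ}
    (hμ : ∀ i j, μ i = μ j) :
    jacobian normalizedLogAbility μ * laplacian n = laplacian n := by
  have h0 : ∑ j, Real.exp (μ j) ≠ 0 :=
    (Finset.sum_pos (fun j _ => Real.exp_pos (μ j)) ⟨⟨0, hn⟩, Finset.mem_univ _⟩).ne'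
  let π (j : Fin n) : (Fin n → ℝ) →L[ℝ] ℝ := ContinuousLinearMap.proj j
  let f' (i : Fin n) : (Fin n → ℝ) →L[ℝ] ℝ :=
    π i - (∑ j, Real.exp (μ j))⁻¹ • ∑ j, Real.exp (μ j) • π j
  have hd : HasFDerivAt (normalizedLogAbility (n := n)) (ContinuousLinearMap.pi f') μ :=
    hasFDerivAt_pi.2 fun i => (π i).hasFDerivAt.sub
      ((HasFDerivAt.fun_sum (u := Finset.univ) fun j _ => (π j).hasFDerivAt.exp).log h0)
  have hJ (i j : Fin n) : jacobian normalizedLogAbility μ i j =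
      (if i = j then 1 else 0) - (∑ j, Real.exp (μ j))⁻¹ * Real.exp (μ i) := by
    rw [jacobian_eq_of_hasFDerivAt hd]
    simp [f', π, Pi.single_apply, hμ j i]
  ext i j
  have hs : ∑ l, laplacian n l j = 0 := by
    simp [laplacian_apply]
  simp only [Matrix.mul_apply, hJ, sub_mul, Finset.sum_sub_distrib, ite_mul, one_mul, zero_mul,
    Finset.sum_ite_eq, Finset.mem_univ, if_true]
  rw [← Finset.mul_sum, hs, mul_zero, sub_zero]

lemma isCramerRaoBound_deltaCovariance (hn : 0 < n) {μ : Fin n → ℝ} (hμ : ∀ i j, μ i = μ j)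
    {k : ℕ} (hk : 0 < k) : IsCramerRaoBound n k μ (deltaCovariance n k μ) := by
  have hn' : (n : ℝ) ≠ 0 := by positivity
  have hk' : (k : ℝ) ≠ 0 := by positivity
  -- V_k itself serves as the Moore–Penrose inverse: (2/(kn²))L inverts (k/2)L because L² = nL, and
  -- D V_k Dᵀ = V_k.
  refine ⟨deltaCovariance n k μ, ?_, ?_⟩
  · rw [deltaCovariance_eq hn hμ hk, fisherInformation_eq hμ]
    simp only [IsMoorePenroseInverse, Matrix.smul_mul, Matrix.mul_smul, laplacian_mul_laplacian,
      Matrix.transpose_smul, laplacian_transpose, smul_smul, and_self, and_true]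
    constructor <;> congr 1 <;> field_simp
  · have h1 := jacobian_normalizedLogAbility_mul_laplacian hn hμ
    have h2 : laplacian n * (jacobian normalizedLogAbility μ).transpose = laplacian n := by
      have := congrArg Matrix.transpose h1
      rwa [Matrix.transpose_mul, laplacian_transpose] at this
    rw [deltaCovariance_eq hn hμ hk]
    simp only [Matrix.mul_smul, Matrix.smul_mul, h1, h2]

/-! ### Asymptotic normality and uniqueness for the two estimators -/

theorem hasAsymptoticCovariance_estimator (hn : 0 < n) {μ : Fin n → ℝ} (hμ : ∀ i j, μ i = μ j)
    {T : ℕ → (Pair n → ℕ) → Fin n → ℝ} {h : (Pair n → ℝ) → (Fin n → ℝ)}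
    (hd : HasFDerivAt h ((2 / n : ℝ) • incidenceCLM n) 0) (h0 : h 0 = fun _ => -Real.log n)
    (hT : ∀ᶠ s in 𝓝 0, ∀ k : ℕ, 0 < k → ∀ x, (k : ℝ) • s = deviation n k x → T k x = h s) :
    HasAsymptoticCovariance T μ (fun k => deltaCovariance n k μ) :=
  ⟨_, laplacian_posSemidef.smul (by positivity), fun _ hk => deltaCovariance_eq hn hμ hk,
    tendstoInDistribution_estimator hn hμ hd h0 hT⟩

lemma tendsto_measureReal_of_eventually_relative {μ : Fin n → ℝ} (hμ : ∀ i j, μ i = μ j)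
    {Q : ℕ → (Pair n → ℕ) → Prop}
    (hQ : ∀ᶠ s in 𝓝 0, ∀ k : ℕ, 0 < k → ∀ x, (k : ℝ) • s = deviation n k x → Q k x) :
    Tendsto (fun k : ℕ => (tournamentLaw n k μ).real {x | Q k x}) atTop (𝓝 1) := by
  refine tendsto_of_tendsto_of_tendsto_of_le_of_le' (tendsto_measureReal_of_eventually hμ hQ)
    tendsto_const_nhds ?_ (Eventually.of_forall fun k => measureReal_le_one)
  filter_upwards [eventually_gt_atTop 0] with k hk
  refine measureReal_mono fun x hx => hx k hk x ?_
  rw [smul_smul, mul_inv_cancel₀ (by positivity), one_smul]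

lemma hasAsymptoticCovariance_logAbilityMLE (hn : 0 < n) {μ : Fin n → ℝ}
    (hμ : ∀ i j, μ i = μ j) :
    HasAsymptoticCovariance (logAbilityMLE n) μ (fun k => deltaCovariance n k μ) := by
  obtain ⟨h, hd, h0, hm⟩ := exists_mle hn
  exact hasAsymptoticCovariance_estimator hn hμ hd h0 (hm.mono fun s hs k hk x hx =>
    logAbilityMLE_eq (hs k hk x hx))

lemma hasAsymptoticCovariance_logInfluenceWeightEstimator (hn : 0 < n) {μ : Fin n → ℝ}
    (hμ : ∀ i j, μ i = μ j) :
    HasAsymptoticCovariance (logInfluenceWeightEstimator n) μ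
      (fun k => deltaCovariance n k μ) := by
  obtain ⟨h, hd, h0, hw⟩ := exists_log_influenceWeight hn
  exact hasAsymptoticCovariance_estimator hn hμ hd h0 (hw.mono fun s hs k hk x hx =>
    log_eq_of_isInfluenceWeight (hx ▸ hs k hk))

lemma tendsto_existsUnique_isMLE (hn : 0 < n) {μ : Fin n → ℝ} (hμ : ∀ i j, μ i = μ j) :
    Tendsto (fun k : ℕ => (tournamentLaw n k μ).real {x | ∃! ν, IsMLE n k x ν}) atTop (𝓝 1) := by
  obtain ⟨h, -, -, hm⟩ := exists_mle hn
  exact tendsto_measureReal_of_eventually_relative hμ (hm.mono fun s hs k hk x hx =>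
    ⟨h s, (hs k hk x hx _).2 rfl, fun ν => (hs k hk x hx ν).1⟩)

lemma tendsto_existsUnique_isInfluenceWeight (hn : 0 < n) {μ : Fin n → ℝ}
    (hμ : ∀ i j, μ i = μ j) :
    Tendsto (fun k : ℕ => (tournamentLaw n k μ).real
      {x | ∃! w, IsInfluenceWeight (perturbedMatrix n k (deviation n k x)) w}) atTop (𝓝 1) := by
  obtain ⟨h, -, -, hw⟩ := exists_log_influenceWeight hn
  refine tendsto_measureReal_of_eventually_relative hμ (hw.mono fun s hs k hk x hx => ?_)
  rw [← hx]
  exact ⟨_, (hs k hk _).2 rfl, fun w => (hs k hk w).1⟩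

end RoundRobin

end

theorem mainTheorem2 (n : ℕ) (hn : 0 < n) (μ : Fin n → ℝ) (hμ : ∀ i j, μ i = μ j) :
    -- the delta-method covariance matrix of the log influence weight
    (∀ k : ℕ, 0 < k →
      (∀ᶠ t in 𝓝 (0 : RoundRobin.Pair n → ℝ),
        ∃! w, RoundRobin.IsInfluenceWeight (RoundRobin.perturbedMatrix n k t) w) ∧
      DifferentiableAt ℝ (RoundRobin.logInfluenceWeight n k) 0 ∧
      ∀ i j, RoundRobin.deltaCovariance n k μ i j =
        (if i = j then 2 * ((n : ℝ) - 1) / ((k : ℝ) * (n : ℝ) ^ 2)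
          else -2 / ((k : ℝ) * (n : ℝ) ^ 2) : ℝ)) ∧
    -- it is the asymptotic covariance matrix of the maximum likelihood estimator
    Tendsto (fun k : ℕ => (RoundRobin.tournamentLaw n k μ).real
      {x | ∃! ν, RoundRobin.IsMLE n k x ν}) atTop (𝓝 1) ∧
    RoundRobin.HasAsymptoticCovariance (RoundRobin.logAbilityMLE n) μ
      (fun k => RoundRobin.deltaCovariance n k μ) ∧
    -- it is also the Cramér–Rao bound, and the log influence weight is asymptotically efficient
    (∀ k : ℕ, 0 < k →
      RoundRobin.IsCramerRaoBound n k μ (RoundRobin.deltaCovariance n k μ)) ∧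
    Tendsto (fun k : ℕ => (RoundRobin.tournamentLaw n k μ).real
      {x | ∃! w, RoundRobin.IsInfluenceWeight
        (RoundRobin.perturbedMatrix n k (RoundRobin.deviation n k x)) w}) atTop (𝓝 1) ∧
    RoundRobin.HasAsymptoticCovariance (RoundRobin.logInfluenceWeightEstimator n) μ
      (fun k => RoundRobin.deltaCovariance n k μ) ∧
    RoundRobin.IsAsymptoticallyEfficientAt (RoundRobin.logInfluenceWeightEstimator n) μ := by
  refine ⟨fun k hk => ⟨RoundRobin.existsUnique_influenceWeight hn hk,
    (RoundRobin.hasFDerivAt_logInfluenceWeight hn hk).differentiableAt, fun i j => ?_⟩,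
    RoundRobin.tendsto_existsUnique_isMLE hn hμ,
    RoundRobin.hasAsymptoticCovariance_logAbilityMLE hn hμ,
    fun k hk => RoundRobin.isCramerRaoBound_deltaCovariance hn hμ hk,
    RoundRobin.tendsto_existsUnique_isInfluenceWeight hn hμ,
    RoundRobin.hasAsymptoticCovariance_logInfluenceWeightEstimator hn hμ,
    fun k => RoundRobin.deltaCovariance n k μ,
    fun k hk => RoundRobin.isCramerRaoBound_deltaCovariance hn hμ hk,
    RoundRobin.hasAsymptoticCovariance_logInfluenceWeightEstimator hn hμ⟩
  have hn' : (n : ℝ) ≠ 0 := by positivity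
  have hk' : (k : ℝ) ≠ 0 := by positivity
  rw [RoundRobin.deltaCovariance_eq hn hμ hk, Matrix.smul_apply, Matrix.smul_apply,
    RoundRobin.laplacian_apply, smul_eq_mul, smul_eq_mul]
  split_ifs <;> field_simp
  ring
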